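/- Let $\{\psi_{lk}: l\ge 0,\ k\in\{0,\dots,2^l-1\}\}$ be an orthonormal basis of $L^2=L^2[0,1]$ (for instance a boundary-corrected wavelet basis), and write $f_{lk}=\langle f,\psi_{lk}\rangle$ for $f\in L^2$. Consider the white noise regression model $dY^{(n)}(t)=f(t)\,dt+dW(t)/\sqrt n$, $t\in[0,1]$, projected onto this basis: the observation is $X^{(n)}=(X_{lk})$, whose law $P_f^{(n)}$ makes the $X_{lk}$ independent with $X_{lk}\sim\mathcal N(f_{lk},1/n)$. Let $H$ be a probability distribution on $\mathbb R$ with density $h$ such that, for some constants $c_1,c_2>0$ and $\kappa\ge 0$: $h$ is symmetric, positive, bounded and non-increasing on $[0,\infty)$; $\log(1/h(x))\le c_1\bigl(1+\log^{1+\kappa}(1+x)\bigr)$ for all $x\ge 0$; and $\overline H(x)=\int_x^\infty h(u)\,du\le c_2/x^2$ for all $x\ge 1$. Let $\Pi$ be the oversmoothed heavy-tailed (OT) prior, that is, the law on $L^2$ of $$f=\sum_{l\ge 0}\sum_{k=0}^{2^l-1}s_l\,\zeta_{lk}\,\psi_{lk},\qquad s_l=2^{-l^2},\qquad \zeta_{lk}\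 \text{i.i.d. of law } H .$$ For $0<\rho<1$ let the $\rho$-tempered posterior be $$\Pi_\rho[B\mid X]=\frac{\int_B \bigl(p_f^{(n)}(X)\bigr)^\rho\,d\Pi(f)}{\int \bigl(p_f^{(n)}(X)\bigr)^\rho\,d\Pi(f)},$$ where $p_f^{(n)}$ is the (jointly measurable) density of $P_f^{(n)}$ with respect to the dominating measure $P_0^{(n)}$. Let $r\in[1,2]$, $\beta,L>0$ with $\beta>1/r-1/2$, and $$\mathcal B^\beta_{rr}(L)=\Bigl\{f\in L^2:\ \sum_{l\ge 0}2^{rl(\beta+1/2-1/r)}\sum_{k}|f_{lk}|^r<L^r\Bigr\}.$$ Then there exists $d>0$ such that for every $f_0\in\mathcal B^\beta_{rr}(L)$ and every $\rho\in(0,1)$, as $n\to\infty$, $$E_{f_0}\,\Pi_\rho\Bigl[\bigl\{f:\ \|f-f_0\|_2>(\log n)^d\,n^{-\beta/(2\beta+1)}\bigr\}\,\Big|\,X^{(n)}\Bigr]\longrightarrow 0,$$ where $E_{f_0}$ is the expectation under $X^{(n)}\sim P_{f_0}^{(n)}$. -/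

import Mathlib

open MeasureTheory ProbabilityTheory Filter Set
open scoped ENNReal NNReal Topology

noncomputable section

/-- The double indices `(l, k)` with `l ≥ 0` and `k ∈ {0, …, 2 ^ l - 1}`. -/
abbrev WaveletIndex : Type := Σ l : ℕ, Fin (2 ^ l)

/-- The Hilbert space `L² = L²[0,1]` of real functions. -/
abbrev L2Unit : Type := Lp ℝ 2 (volume.restrict (Icc (0 : ℝ) 1))

instance instMeasurableSpaceL2Unit : MeasurableSpace L2Unit := borel L2Unit

instance instBorelSpaceL2Unit : BorelSpace L2Unit := ⟨rfl⟩

/-- An orthonormal basis `{ψ_{lk}}` of `L²[0,1]` with wavelet-type double indices. -/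
abbrev DoubleIndexBasis : Type := HilbertBasis WaveletIndex ℝ L2Unit

/-- The coefficients `f_{lk} = ⟨f, ψ_{lk}⟩`. -/
def coeffs (ψ : DoubleIndexBasis) (f : L2Unit) (i : WaveletIndex) : ℝ := inner ℝ (ψ i) f

/-- The ball `B^β_{rr}(L)`: all `f` such that
`∑_l 2 ^ (r l (β + 1/2 - 1/r)) ∑_k |f_{lk}| ^ r < L ^ r`. The series is taken in `[0, ∞]`. -/
def besovBall (ψ : DoubleIndexBasis) (β r L : ℝ) : Set L2Unit :=
  {f | ∑' l : ℕ, ENNReal.ofReal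
      ((2 : ℝ) ^ (r * l * (β + 1 / 2 - 1 / r)) * ∑ k : Fin (2 ^ l), |coeffs ψ f ⟨l, k⟩| ^ r)
    < ENNReal.ofReal (L ^ r)}

/-- The conditions on the density `h` of the heavy-tailed law: it is symmetric, positive, bounded
and decreasing on `[0, ∞)`, and `log (1 / h x) ≤ c₁ (1 + log ^ (1 + κ) (1 + x))` for `x ≥ 0`. -/
structure IsHeavyTailDensity (h : ℝ → ℝ) (c₁ κ : ℝ) : Prop where
  symm : ∀ x, h (-x) = h x
  pos : ∀ x, 0 < h x
  bdd : ∃ M : ℝ, ∀ x, h x ≤ M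
  anti : AntitoneOn h (Ici 0)
  log_le : ∀ x, 0 ≤ x → Real.log (1 / h x) ≤ c₁ * (1 + Real.log (1 + x) ^ (1 + κ))

/-- The scale parameters `s_l = 2 ^ (-l²)` of the oversmoothed heavy-tailed prior. -/
def otScale (l : ℕ) : ℝ := (2 : ℝ) ^ (-((l : ℝ) ^ 2))

/-- The function `∑_{l,k} s_l ζ_{lk} ψ_{lk}`, the series converging in `L²[0,1]`. -/
def otSeries (ψ : DoubleIndexBasis) (ζ : WaveletIndex → ℝ) : L2Unit :=
  ∑' i : WaveletIndex, (otScale i.1 * ζ i) • ψ i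

/-- The oversmoothed heavy-tailed prior: the law on `L²[0,1]` of the random series
`∑_{l,k} s_l ζ_{lk} ψ_{lk}` with `ζ_{lk}` independent of common law `H`. -/
def otPrior (ψ : DoubleIndexBasis) (H : Measure ℝ) : Measure L2Unit :=
  (Measure.infinitePi (fun _ : WaveletIndex => H)).map (otSeries ψ)

/-- The law `P_f^{(n)}` of the observation sequence of the white noise model
`dY(t) = f(t) dt + dW(t) / √n` projected onto the basis: the `X_{lk}` are independent with
`X_{lk} ∼ N(f_{lk}, 1/n)`. -/
def obsLaw (ψ : DoubleIndexBasis) (n : ℕ) (f : L2Unit) : Measure (WaveletIndex → ℝ) :=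
  Measure.infinitePi (fun i => gaussianReal (coeffs ψ f i) (1 / (n : ℝ≥0)))

instance instIsProbabilityMeasureObsLaw (ψ : DoubleIndexBasis) (n : ℕ) (f : L2Unit) :
    IsProbabilityMeasure (obsLaw ψ n f) := by
  unfold obsLaw; infer_instance

theorem measurable_coeffs (ψ : DoubleIndexBasis) : Measurable (coeffs ψ) := by
  refine measurable_pi_lambda _ fun i => ?_
  have : Continuous fun f : L2Unit => (inner ℝ (ψ i) f : ℝ) := by fun_prop
  exact this.measurable

theorem obsLaw_eq_map (ψ : DoubleIndexBasis) (n : ℕ) (f : L2Unit) :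
    obsLaw ψ n f =
      (Measure.infinitePi (fun _ : WaveletIndex => gaussianReal 0 (1 / (n : ℝ≥0)))).map
        (fun x i => x i + coeffs ψ f i) := by
  have h := Measure.infinitePi_map_pi
    (fun _ : WaveletIndex => gaussianReal 0 (1 / (n : ℝ≥0)))
    (f := fun i (x : ℝ) => x + coeffs ψ f i) (fun i => by fun_prop)
  simp only [gaussianReal_map_add_const, zero_add] at h
  exact h.symm

theorem measurable_obsLaw (ψ : DoubleIndexBasis) (n : ℕ) : Measurable (obsLaw ψ n) := by
  refine Measure.measurable_of_measurable_coe _ fun s hs => ?_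
  have hm : Measurable fun p : L2Unit × (WaveletIndex → ℝ) => fun i => p.2 i + coeffs ψ p.1 i :=
    measurable_pi_lambda _ fun i => ((measurable_pi_apply i).comp measurable_snd).add
      ((measurable_pi_apply i).comp ((measurable_coeffs ψ).comp measurable_fst))
  have h2 := measurable_measure_prodMk_left
    (ν := Measure.infinitePi (fun _ : WaveletIndex => gaussianReal 0 (1 / (n : ℝ≥0)))) (hm hs)
  convert h2 using 2 with f
  rw [obsLaw_eq_map]
  exact Measure.map_apply (hm.comp measurable_prodMk_left) hs

/-- The statistical model `f ↦ P_f^{(n)}` as a Markov kernel. -/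
def obsKernel (ψ : DoubleIndexBasis) (n : ℕ) : Kernel L2Unit (WaveletIndex → ℝ) where
  toFun := obsLaw ψ n
  measurable' := measurable_obsLaw ψ n

instance instIsMarkovKernelObsKernel (ψ : DoubleIndexBasis) (n : ℕ) :
    IsMarkovKernel (obsKernel ψ n) :=
  ⟨fun f => instIsProbabilityMeasureObsLaw ψ n f⟩

/-- The likelihood `p_f^{(n)}(x)`: the jointly measurable version of the density of `P_f^{(n)}`
with respect to the dominating measure `P_0^{(n)}` (the law of the observations when `f = 0`). -/
def likelihood (ψ : DoubleIndexBasis) (n : ℕ) (f : L2Unit) (x : WaveletIndex → ℝ) : ℝ≥0∞ :=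
  Kernel.rnDeriv (obsKernel ψ n) (Kernel.const L2Unit (obsLaw ψ n 0)) f x

/-- The tempered posterior
`Π_ρ[B | x] = ∫_B p_f(x) ^ ρ dΠ(f) / ∫ p_f(x) ^ ρ dΠ(f)`. -/
def temperedPosterior (ψ : DoubleIndexBasis) (prior : Measure L2Unit) (ρ : ℝ) (n : ℕ)
    (x : WaveletIndex → ℝ) (B : Set L2Unit) : ℝ≥0∞ :=
  (∫⁻ f in B, likelihood ψ n f x ^ ρ ∂prior) / ∫⁻ f, likelihood ψ n f x ^ ρ ∂prior

/-- The random series is a measurable function of the variables `ζ_{lk}`, so that the prior is the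
law of an `L²[0,1]`-valued random variable. -/
theorem measurable_otSeries (ψ : DoubleIndexBasis) : Measurable (otSeries ψ) := by
  have : Fact ((2 : ℝ≥0∞) ≠ ∞) := ⟨by simp⟩
  have : SecondCountableTopology L2Unit := Lp.SecondCountableTopology
  have hterm (i : WaveletIndex) :
      Measurable fun ζ : WaveletIndex → ℝ => (otScale i.1 * ζ i) • ψ i := by
    have : Continuous fun t : ℝ => (otScale i.1 * t) • ψ i := by fun_prop
    exact this.measurable.comp (measurable_pi_apply i)
  let S : Set (WaveletIndex → ℝ) := {ζ | Summable fun i => (otScale i.1 * ζ i) • ψ i}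
  have hS : MeasurableSet S := by
    have hiff : S = {ζ | ∑' i : WaveletIndex, ENNReal.ofReal ((otScale i.1 * ζ i) ^ 2) ≠ ∞} := by
      ext ζ
      have h1 := ψ.orthonormal.orthogonalFamily.summable_iff_norm_sq_summable
        (fun i => otScale i.1 * ζ i)
      simp only [LinearIsometry.toSpanSingleton_apply, Real.norm_eq_abs, sq_abs] at h1
      change Summable _ ↔ _
      rw [h1]
      constructor
      · intro h
        exact h.tsum_ofReal_ne_top
      · intro h
        have := ENNReal.summable_toReal h
        simpa [ENNReal.toReal_ofReal, sq_nonneg] using this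
    rw [hiff]
    have hmeas : Measurable fun ζ : WaveletIndex → ℝ =>
        ∑' i : WaveletIndex, ENNReal.ofReal ((otScale i.1 * ζ i) ^ 2) :=
      Measurable.tsum fun i => by fun_prop
    exact (hmeas (measurableSet_singleton ∞)).compl
  obtain ⟨e⟩ : Nonempty (WaveletIndex ≃ ℕ) := by
    have : Infinite WaveletIndex :=
      Infinite.of_injective (fun l : ℕ => (⟨l, 0⟩ : WaveletIndex)) fun a b h => by
        simpa using congrArg Sigma.fst h
    exact nonempty_equiv_of_countable
  refine measurable_of_tendsto_metrizable
    (f := fun n => S.indicator fun ζ =>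
      ∑ j ∈ Finset.range n, (otScale (e.symm j).1 * ζ (e.symm j)) • ψ (e.symm j))
    (fun n => (Finset.measurable_fun_sum _ fun j _ => hterm (e.symm j)).indicator hS) ?_
  rw [tendsto_pi_nhds]
  intro ζ
  by_cases hζ : ζ ∈ S
  · simp only [indicator_of_mem hζ]
    have h := (e.symm.hasSum_iff.mpr hζ.hasSum).tendsto_sum_nat
    exact h
  · simp only [indicator_of_notMem hζ]
    rw [otSeries, tsum_eq_zero_of_not_summable hζ]
    exact tendsto_const_nhds

end

/-! Tempering removes the need for tests or sieves: for any prior `Π`, the expected `ρ`-posterior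
mass of `{‖f - f₀‖ > T}` is at most `Π(‖f - f₀‖ ≤ ε)^(-1/2) * exp (nρ(1+ρ)ε²/4 - nρ(1-ρ)T²/4)`,
which is `lintegral_temperedPosterior_le`. It follows from two uses of Cauchy–Schwarz, over `f` to
bound the normalising constant from below and over `x` to separate it from the numerator, together
with the Gaussian identity `∫ p_f^s p_g^(1-s) dP_0 = exp (-n s(1-s)‖f-g‖²/2)`, valid for every real
`s`. It is used with `s = ρ` on the far set and `s = -ρ` on the small ball. The identity rests on
the Cameron–Martin formula for infinite products of Gaussians.

What remains is the prior mass of an `L²` ball with `nε²` of order `N = n^(1/(2β+1))`, given by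
`exists_exp_le_otPrior_ball`. Besov regularity yields a set `S` of `O(N)` significant indices: the
levels with `2^l ≤ N` and the coefficients exceeding `n^(-1/2)`. These indices lie at levels `l =
O(log n)`, so matching one of them to within `n^(-1/2)` asks `ζ` to reach a point of logarithmic
size `O(l²) = O(log² n)`; the heavy tail makes this cost only `exp (-C log^(2+2κ) n)`. Off `S` the
truth is negligible, and the scales `2^(-l²)` are so small that all remaining coordinates are
simultaneously tiny with probability at least `1/2`. Hence the mass is at least `exp (-C N
log^(2+2κ) n)`, which `nT² = N log^(2d) n` dominates for `d = 2 + 2κ`. -/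

noncomputable section

/-! ### Shifts of Gaussian product measures -/

/-- The density at `x` of `N(a, v)` with respect to `N(0, v)`. -/
def gaussianTilt (v : ℝ≥0) (a x : ℝ) : ℝ≥0∞ :=
  ENNReal.ofReal (Real.exp ((a * x - a ^ 2 / 2) / v))

@[fun_prop]
theorem measurable_gaussianTilt (v : ℝ≥0) (a : ℝ) : Measurable (gaussianTilt v a) := by
  unfold gaussianTilt; fun_prop

theorem gaussianReal_eq_withDensity_gaussianTilt {v : ℝ≥0} (hv : v ≠ 0) (a : ℝ) :
    gaussianReal a v = (gaussianReal 0 v).withDensity (gaussianTilt v a) := by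
  rw [gaussianReal_of_var_ne_zero _ hv, gaussianReal_of_var_ne_zero _ hv,
    ← withDensity_mul _ (measurable_gaussianPDF 0 v) (measurable_gaussianTilt v a)]
  congr 1
  ext x
  simp only [gaussianPDF, gaussianTilt, Pi.mul_apply, gaussianPDFReal]
  rw [← ENNReal.ofReal_mul (by positivity), mul_assoc _ (Real.exp _), ← Real.exp_add]
  have : (v : ℝ) ≠ 0 := by exact_mod_cast hv
  congr 3
  field_simp
  ring

section product

variable {ι : Type*}

/-- The linear statistic `∑_{i ∈ F} a_i x_i`. -/
def linearStat (a : ι → ℝ) (F : Finset ι) (x : ι → ℝ) : ℝ := ∑ i ∈ F, a i * x i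

@[fun_prop]
theorem measurable_linearStat (a : ι → ℝ) (F : Finset ι) : Measurable (linearStat a F) := by
  unfold linearStat; fun_prop

theorem prod_gaussianTilt (v : ℝ≥0) (a : ι → ℝ) (F : Finset ι) (x : ι → ℝ) :
    ∏ i ∈ F, gaussianTilt v (a i) (x i)
      = ENNReal.ofReal (Real.exp ((linearStat a F x - (∑ i ∈ F, a i ^ 2) / 2) / v)) := by
  simp only [gaussianTilt]
  rw [← ENNReal.ofReal_prod_of_nonneg (fun _ _ => (Real.exp_pos _).le), ← Real.exp_sum,
    ← Finset.sum_div, Finset.sum_sub_distrib, linearStat, Finset.sum_div]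

/-- By independence the integral factorises, and the coordinates in `F \ s` contribute total mass
one. Thus the value on a cylinder no longer changes once `F` contains its base `s`. -/
theorem setLIntegral_prod_gaussianTilt {v : ℝ≥0} (hv : v ≠ 0) (a : ι → ℝ) {s F : Finset ι}
    (hs : s ⊆ F) {t : ι → Set ℝ} (ht : ∀ i, MeasurableSet (t i)) :
    ∫⁻ x in Set.pi s t, ∏ i ∈ F, gaussianTilt v (a i) (x i)
        ∂(Measure.infinitePi fun _ : ι => gaussianReal 0 v)
      = ∏ i ∈ s, gaussianReal (a i) v (t i) := by
  classical
  -- The indicator of the cylinder is absorbed coordinate by coordinate into the factors.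
  let k : ι → ℝ → ℝ≥0∞ := fun i =>
    (if i ∈ s then t i else univ).indicator (gaussianTilt v (a i))
  have hT : ∀ i, MeasurableSet (if i ∈ s then t i else univ) := fun i => by
    split_ifs
    · exact ht i
    · exact .univ
  have hk : ∀ i, Measurable (k i) := fun i => (measurable_gaussianTilt v (a i)).indicator (hT i)
  have hki : ∀ i, ∫⁻ x, k i x ∂(gaussianReal 0 v)
      = gaussianReal (a i) v (if i ∈ s then t i else univ) := fun i => by
    rw [lintegral_indicator (hT i), ← withDensity_apply _ (hT i),
      ← gaussianReal_eq_withDensity_gaussianTilt hv]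
  have hpi : MeasurableSet (Set.pi (s : Set ι) t) :=
    MeasurableSet.pi s.countable_toSet fun i _ => ht i
  rw [← lintegral_indicator hpi]
  have hprod : ∀ x : ι → ℝ, (Set.pi (s : Set ι) t).indicator
      (fun x => ∏ i ∈ F, gaussianTilt v (a i) (x i)) x = ∏ i ∈ F, k i (x i) := fun x => by
    by_cases hx : x ∈ Set.pi (s : Set ι) t
    · rw [indicator_of_mem hx]
      refine Finset.prod_congr rfl fun i _ => ?_
      have : x i ∈ (if i ∈ s then t i else univ) := by
        split_ifs with h
        · exact hx i h
        · trivial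
      simp only [k, indicator_of_mem this]
    · rw [indicator_of_notMem hx]
      simp only [Set.mem_pi, not_forall] at hx
      obtain ⟨i, hi, hxi⟩ := hx
      symm
      refine Finset.prod_eq_zero (hs hi) ?_
      have hi' : i ∈ s := hi
      simp [k, hi', hxi]
  simp_rw [hprod]
  have hind := iIndepFun_infinitePi (P := fun _ : ι => gaussianReal 0 v) hk
  refine (lintegral_prod_eq_prod_lintegral_of_indepFun F (fun i (x : ι → ℝ) => k i (x i)) hind
    (fun i => (hk i).comp (measurable_pi_apply i))).trans ?_
  have : ∀ i, ∫⁻ x : ι → ℝ, k i (x i) ∂(Measure.infinitePi fun _ : ι => gaussianReal 0 v)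
      = gaussianReal (a i) v (if i ∈ s then t i else univ) := fun i => by
    rw [← hki]
    exact (measurePreserving_eval_infinitePi (fun _ : ι => gaussianReal 0 v) i).lintegral_comp
      (hk i)
  simp_rw [this]
  rw [← Finset.prod_subset hs]
  · exact Finset.prod_congr rfl fun i hi => by simp [hi]
  · intro i _ hi
    simp [hi]

theorem lintegral_exp_linearStat {v : ℝ≥0} (hv : v ≠ 0) (a : ι → ℝ) (F : Finset ι) (c : ℝ) :
    ∫⁻ x, ENNReal.ofReal (Real.exp ((linearStat a F x - c) / v))
        ∂(Measure.infinitePi fun _ : ι => gaussianReal 0 v)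
      = ENNReal.ofReal (Real.exp (((∑ i ∈ F, a i ^ 2) / 2 - c) / v)) := by
  have h := setLIntegral_prod_gaussianTilt hv a (Finset.empty_subset F) (t := fun _ => univ)
    (fun _ => .univ)
  simp only [Finset.coe_empty, empty_pi, Measure.restrict_univ, Finset.prod_empty,
    prod_gaussianTilt] at h
  have h2 : ∀ x : ι → ℝ, ENNReal.ofReal (Real.exp ((linearStat a F x - c) / v))
      = ENNReal.ofReal (Real.exp ((linearStat a F x - (∑ i ∈ F, a i ^ 2) / 2) / v))
        * ENNReal.ofReal (Real.exp (((∑ i ∈ F, a i ^ 2) / 2 - c) / v)) := fun x => by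
    rw [← ENNReal.ofReal_mul (Real.exp_pos _).le, ← Real.exp_add]
    congr 2
    ring
  simp_rw [h2]
  rw [lintegral_mul_const _ (by fun_prop), h, one_mul]

/-- The statistic `Z` is the almost sure limit of `∑_{j < m} a_{e j} x_{e j}` under the law of
independent `N(0, v)` coordinates. -/
def IsLinearLimit (v : ℝ≥0) (e : ℕ ≃ ι) (a : ι → ℝ) (Z : (ι → ℝ) → ℝ) : Prop :=
  ∀ᵐ x ∂(Measure.infinitePi fun _ : ι => gaussianReal 0 v),
    Tendsto (fun m => linearStat a ((Finset.range m).map e.toEmbedding) x) atTop (𝓝 (Z x))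

/-- This linearity is what later turns a geometric mixture of two likelihoods into a multiple of a
third one. -/
theorem IsLinearLimit.lincomb {v : ℝ≥0} {e : ℕ ≃ ι} {a b : ι → ℝ} {Z W : (ι → ℝ) → ℝ}
    (hZ : IsLinearLimit v e a Z) (hW : IsLinearLimit v e b W) (s t : ℝ) :
    IsLinearLimit v e (fun i => s * a i + t * b i) (fun x => s * Z x + t * W x) := by
  filter_upwards [hZ, hW] with x hx hy
  refine ((hx.const_mul s).add (hy.const_mul t)).congr fun m => ?_
  simp only [linearStat, Finset.mul_sum, ← Finset.sum_add_distrib]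
  exact Finset.sum_congr rfl fun i _ => by ring

/-- The partial sums form a martingale bounded in `L¹`, so Doob's theorem gives almost sure
convergence. -/
theorem exists_isLinearLimit {v : ℝ≥0} (hv : v ≠ 0) (e : ℕ ≃ ι) {a : ι → ℝ}
    (ha : Summable fun i => a i ^ 2) :
    ∃ Z : (ι → ℝ) → ℝ, Measurable Z ∧ IsLinearLimit v e a Z := by
  set P := Measure.infinitePi fun _ : ι => gaussianReal 0 v with hP
  let g : ℕ → (ι → ℝ) → ℝ := fun j x => a (e j) * x (e j)
  have hg : ∀ j, StronglyMeasurable (g j) := fun j =>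
    Measurable.stronglyMeasurable (by fun_prop)
  have hind0 : iIndepFun (fun i (x : ι → ℝ) => a i * x i) P :=
    iIndepFun_infinitePi (P := fun _ : ι => gaussianReal 0 v) (X := fun i x => a i * x)
      (fun i => by fun_prop)
  have hind : iIndepFun g P := hind0.precomp e.injective
  have heval : ∀ i, HasLaw (fun x : ι → ℝ => x i) (gaussianReal 0 v) P := fun i =>
    ⟨(measurable_pi_apply i).aemeasurable, Measure.infinitePi_map_eval _ i⟩
  have hintx : ∀ i, Integrable (fun x : ι → ℝ => x i) P := fun i => by
    have := (memLp_id_gaussianReal (μ := 0) (v := v) 1).integrable (by simp)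
    rw [← Measure.infinitePi_map_eval (fun _ : ι => gaussianReal 0 v) i] at this
    exact this.comp_measurable (measurable_pi_apply i)
  have hint : ∀ j, Integrable (g j) P := fun j => (hintx (e j)).const_mul _
  have hmean : ∀ j, P[g j] = 0 := fun j => by
    simp only [g]
    rw [integral_const_mul, (heval (e j)).integral_eq]
    simp
  let 𝒢 := Filtration.natural g hg
  let S : ℕ → (ι → ℝ) → ℝ := fun m x => ∑ j ∈ Finset.range (m + 1), g j x
  have hSint : ∀ m, Integrable (S m) P := fun m => integrable_finsetSum _ fun j _ => hint j
  have hadp : StronglyAdapted 𝒢 S := fun m => by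
    refine Finset.stronglyMeasurable_fun_sum _ fun j hj => ?_
    exact (Filtration.stronglyAdapted_natural hg j).mono
      (𝒢.mono (Nat.lt_succ_iff.1 (Finset.mem_range.1 hj)))
  have hmart : Martingale S 𝒢 P := by
    refine martingale_nat hadp hSint fun m => ?_
    have h1 : S (m + 1) = S m + g (m + 1) := by
      ext x; simp [S, Finset.sum_range_succ _ (m + 1)]
    rw [h1]
    have h2 := condExp_add (hSint m) (hint (m + 1)) (𝒢 m)
    have h3 := hind.condExp_natural_ae_eq_of_lt hg (Nat.lt_succ_self m)
    have h4 : P[S m | 𝒢 m] = S m := condExp_of_stronglyMeasurable (𝒢.le m) (hadp m) (hSint m)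
    filter_upwards [h2, h3] with x hx2 hx3
    rw [hx2, Pi.add_apply, h4]
    have : (P[g (m + 1) | 𝒢 m]) x = 0 := by
      rw [hx3]; exact hmean (m + 1)
    rw [this, add_zero]
  have hSlin : ∀ m x, S m x = linearStat a ((Finset.range (m + 1)).map e.toEmbedding) x := by
    intro m x
    simp [S, g, linearStat]
  -- The bound comes from `|y| ≤ exp y + exp (-y)` and Gaussian exponential moments; the factor `v`
  -- in `v * a i` cancels the division by `v` in `lintegral_exp_linearStat`.
  let R : ℝ≥0 := (2 * Real.exp (((∑' i, (v * a i) ^ 2) / 2) / v)).toNNReal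
  have hbdd : ∀ m, eLpNorm (S m) 1 P ≤ R := fun m => by
    rw [eLpNorm_one_eq_lintegral_enorm]
    set F := (Finset.range (m + 1)).map e.toEmbedding
    have hle : ∀ x, ‖S m x‖ₑ ≤
        ENNReal.ofReal (Real.exp ((linearStat (fun i => v * a i) F x - 0) / v))
        + ENNReal.ofReal (Real.exp ((linearStat (fun i => -(v * a i)) F x - 0) / v)) := fun x => by
      rw [← ENNReal.ofReal_add (Real.exp_pos _).le (Real.exp_pos _).le, Real.enorm_eq_ofReal_abs]
      apply ENNReal.ofReal_le_ofReal
      have hv' : (v : ℝ) ≠ 0 := by exact_mod_cast hv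
      have e1 : (linearStat (fun i => v * a i) F x - 0) / v = S m x := by
        rw [hSlin]
        simp only [linearStat, mul_assoc, ← Finset.mul_sum, sub_zero]
        field_simp
        rfl
      have e2 : (linearStat (fun i => -(v * a i)) F x - 0) / v = -S m x := by
        rw [← e1]
        simp [linearStat, neg_div]
      rw [e1, e2]
      rcases abs_cases (S m x) with ⟨h, _⟩ | ⟨h, _⟩ <;> rw [h]
      · linarith [Real.add_one_le_exp (S m x), Real.exp_pos (-S m x)]
      · linarith [Real.add_one_le_exp (-S m x), Real.exp_pos (S m x)]
    refine (lintegral_mono hle).trans ?_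
    rw [lintegral_add_left (by fun_prop), lintegral_exp_linearStat hv, lintegral_exp_linearStat hv,
      ← ENNReal.ofReal_add (Real.exp_pos _).le (Real.exp_pos _).le]
    apply ENNReal.ofReal_le_ofReal
    have hsum : ∑ i ∈ F, (v * a i) ^ 2 ≤ ∑' i, (v * a i) ^ 2 := by
      refine Summable.sum_le_tsum _ (fun _ _ => by positivity) ?_
      simpa only [mul_pow] using ha.mul_left _
    have : Real.exp (((∑ i ∈ F, (v * a i) ^ 2) / 2 - 0) / v) ≤
        Real.exp (((∑' i, (v * a i) ^ 2) / 2) / v) := by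
      rw [sub_zero]; gcongr
    simp only [neg_sq]
    linarith
  have hconv := hmart.submartingale.exists_ae_tendsto_of_bdd hbdd
  have hmeas : ∀ m, Measurable (S m) := fun m => Finset.measurable_fun_sum _ fun j _ => by fun_prop
  obtain ⟨Z, hZ, hlim⟩ := measurable_limit_of_tendsto_metrizable_ae (μ := P)
    (fun m => (hmeas m).aemeasurable) hconv
  refine ⟨Z, hZ, ?_⟩
  filter_upwards [hlim] with x hx
  rw [← tendsto_add_atTop_iff_nat 1]
  exact hx.congr fun m => hSlin m x

end product

/-- Convergence of integrals under a uniform bound on the second moments. -/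
theorem lintegral_eq_of_tendsto_of_sq_le {α : Type*} [MeasurableSpace α] {μ : Measure α}
    [IsFiniteMeasure μ] {f : ℕ → α → ℝ≥0∞} {g : α → ℝ≥0∞} {c C : ℝ≥0∞}
    (hf : ∀ m, Measurable (f m)) (hlim : ∀ᵐ x ∂μ, Tendsto (fun m => f m x) atTop (𝓝 (g x)))
    (hC : C ≠ ∞) (hsq : ∀ m, ∫⁻ x, f m x ^ 2 ∂μ ≤ C)
    (hc : ∀ᶠ m in atTop, ∫⁻ x, f m x ∂μ = c) : ∫⁻ x, g x ∂μ = c := by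
  apply le_antisymm
  · calc ∫⁻ x, g x ∂μ = ∫⁻ x, liminf (fun m => f m x) atTop ∂μ :=
          lintegral_congr_ae (hlim.mono fun x hx => hx.liminf_eq.symm)
      _ ≤ liminf (fun m => ∫⁻ x, f m x ∂μ) atTop := lintegral_liminf_le hf
      _ = liminf (fun _ : ℕ => c) atTop := liminf_congr hc
      _ = c := liminf_const c
  -- Uniform integrability by truncation: `f ≤ min f K + f² / K`, with dominated convergence for the
  -- truncated part, then `K → ∞`.
  · have key : ∀ K : ℕ, 0 < K → c ≤ ∫⁻ x, g x ∂μ + C / K := fun K hK => by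
      have hKpos : (K : ℝ≥0∞) ≠ 0 := by exact_mod_cast hK.ne'
      have hKtop : (K : ℝ≥0∞) ≠ ∞ := ENNReal.natCast_ne_top K
      have h1 : ∀ m, ∫⁻ x, f m x ∂μ ≤ ∫⁻ x, min (f m x) K ∂μ + C / K := fun m => by
        calc ∫⁻ x, f m x ∂μ ≤ ∫⁻ x, (min (f m x) K + f m x ^ 2 / K) ∂μ := by
              refine lintegral_mono fun x => ?_
              rcases le_total (f m x) K with h | h
              · rw [min_eq_left h]; exact le_self_add
              · refine le_add_left ?_
                rw [ENNReal.le_div_iff_mul_le (Or.inl hKpos) (Or.inl hKtop), sq]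
                gcongr
          _ = ∫⁻ x, min (f m x) K ∂μ + (∫⁻ x, f m x ^ 2 ∂μ) / K := by
              rw [lintegral_add_left ((hf m).min measurable_const)]
              simp only [div_eq_mul_inv]
              rw [lintegral_mul_const _ ((hf m).pow_const 2)]
          _ ≤ _ := by gcongr; exact hsq m
      have h2 : Tendsto (fun m => ∫⁻ x, min (f m x) K ∂μ) atTop
          (𝓝 (∫⁻ x, min (g x) K ∂μ)) := by
        refine tendsto_lintegral_of_dominated_convergence (fun _ => (K : ℝ≥0∞))
          (fun m => (hf m).min measurable_const) (fun m => ae_of_all _ fun x => min_le_right _ _)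
          ?_ (hlim.mono fun x hx => hx.min tendsto_const_nhds)
        simp [ENNReal.mul_eq_top, measure_ne_top]
      have h3 : c ≤ ∫⁻ x, min (g x) K ∂μ + C / K := by
        refine ge_of_tendsto (h2.add_const _) ?_
        filter_upwards [hc] with m hm
        rw [← hm]; exact h1 m
      refine h3.trans ?_
      gcongr
      exact min_le_left _ _
    have hlim0 : Tendsto (fun K : ℕ => ∫⁻ x, g x ∂μ + C / K) atTop
        (𝓝 (∫⁻ x, g x ∂μ + 0)) :=
      (ENNReal.Tendsto.const_div ENNReal.tendsto_nat_nhds_top (Or.inr hC)).const_add _ |>.trans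
        (by simp)
    rw [add_zero] at hlim0
    exact ge_of_tendsto hlim0 ((eventually_gt_atTop 0).mono key)

/-- Cameron–Martin formula. The densities of the finite truncations converge almost surely and are
bounded in `L²`, hence their integrals over a cylinder converge; these integrals are eventually
constant, equal to the shifted probability. -/
theorem infinitePi_gaussianReal_eq_withDensity {ι : Type*} {v : ℝ≥0} (hv : v ≠ 0)
    (e : ℕ ≃ ι) {a : ι → ℝ} (ha : Summable fun i => a i ^ 2) {Z : (ι → ℝ) → ℝ}
    (hZ : IsLinearLimit v e a Z) :
    (Measure.infinitePi fun i => gaussianReal (a i) v) =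
      (Measure.infinitePi fun _ : ι => gaussianReal 0 v).withDensity
        fun x => ENNReal.ofReal (Real.exp ((Z x - (∑' i, a i ^ 2) / 2) / v)) := by
  symm
  refine Measure.eq_infinitePi _ fun s t ht => ?_
  set P := Measure.infinitePi fun _ : ι => gaussianReal 0 v
  have hpi : MeasurableSet (Set.pi (s : Set ι) t) :=
    MeasurableSet.pi s.countable_toSet fun i _ => ht i
  rw [withDensity_apply _ hpi]
  let F : ℕ → Finset ι := fun m => (Finset.range m).map e.toEmbedding
  have hF : Tendsto F atTop atTop := by
    refine tendsto_atTop_finset_of_monotone (fun m k hmk => ?_) fun i => ⟨e.symm i + 1, ?_⟩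
    · exact Finset.map_subset_map.2 (Finset.range_mono hmk)
    · simp [F]
  refine lintegral_eq_of_tendsto_of_sq_le
    (f := fun m x => ∏ i ∈ F m, gaussianTilt v (a i) (x i))
    (C := ENNReal.ofReal (Real.exp ((∑' i, a i ^ 2) / v))) (fun m => by fun_prop) ?_
    ENNReal.ofReal_ne_top (fun m => ?_) ?_
  · refine ae_restrict_of_ae (hZ.mono fun x hx => ?_)
    simp_rw [prod_gaussianTilt]
    refine (ENNReal.continuous_ofReal.tendsto _).comp ((Real.continuous_exp.tendsto _).comp ?_)
    have := ha.hasSum.comp hF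
    exact (hx.sub (this.div_const 2)).div_const _
  -- Squaring doubles the linear term, so the mean is `exp ((4/2 - 1) ∑ a² / v)`, whence the choice
  -- of `C`.
  · have h1 : ∀ x : ι → ℝ, (∏ i ∈ F m, gaussianTilt v (a i) (x i)) ^ 2 =
        ENNReal.ofReal (Real.exp ((linearStat (fun i => 2 * a i) (F m) x
          - ∑ i ∈ F m, a i ^ 2) / v)) := fun x => by
      rw [prod_gaussianTilt, ← ENNReal.ofReal_pow (Real.exp_pos _).le, ← Real.exp_nat_mul]
      congr 2
      simp only [linearStat, mul_assoc, ← Finset.mul_sum]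
      push_cast
      ring
    refine (setLIntegral_le_lintegral _ _).trans ?_
    simp_rw [h1]
    rw [lintegral_exp_linearStat hv]
    refine ENNReal.ofReal_le_ofReal (Real.exp_le_exp.2 ?_)
    have h2 : ∑ i ∈ F m, (2 * a i) ^ 2 = 4 * ∑ i ∈ F m, a i ^ 2 := by
      rw [Finset.mul_sum]; exact Finset.sum_congr rfl fun i _ => by ring
    rw [h2]
    have h3 : ∑ i ∈ F m, a i ^ 2 ≤ ∑' i, a i ^ 2 := ha.sum_le_tsum _ fun _ _ => by positivity
    gcongr
    linarith
  · filter_upwards [hF.eventually_ge_atTop s] with m hm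
    exact setLIntegral_prod_gaussianTilt hv a hm ht

/-! ### Likelihoods in the sequence model -/

theorem hasSum_coeffs_sq (ψ : DoubleIndexBasis) (f : L2Unit) :
    HasSum (fun i => coeffs ψ f i ^ 2) (‖f‖ ^ 2) := by
  have h := ψ.hasSum_inner_mul_inner f f
  rw [real_inner_self_eq_norm_sq] at h
  refine h.congr_fun fun i => ?_
  rw [coeffs, real_inner_comm f, sq]

theorem coeffs_lincomb (ψ : DoubleIndexBasis) (s t : ℝ) (f g : L2Unit) :
    coeffs ψ (s • f + t • g) = fun i => s * coeffs ψ f i + t * coeffs ψ g i := by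
  ext i
  simp only [coeffs, inner_add_right, inner_smul_right]

theorem obsLaw_zero (ψ : DoubleIndexBasis) (n : ℕ) :
    obsLaw ψ n 0 = Measure.infinitePi fun _ => gaussianReal 0 (1 / (n : ℝ≥0)) := by
  simp [obsLaw, coeffs]

theorem nonempty_equiv_waveletIndex : Nonempty (ℕ ≃ WaveletIndex) := by
  have : Infinite WaveletIndex :=
    Infinite.of_injective (fun l : ℕ => (⟨l, 0⟩ : WaveletIndex)) fun a b h => by
      simpa using congrArg Sigma.fst h
  exact nonempty_equiv_of_countable

section likelihood

variable (ψ : DoubleIndexBasis) {n : ℕ} (hn : n ≠ 0)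
include hn

theorem obsLaw_eq_withDensity_exp {e : ℕ ≃ WaveletIndex} {f : L2Unit}
    {Z : (WaveletIndex → ℝ) → ℝ} (hZ : IsLinearLimit (1 / (n : ℝ≥0)) e (coeffs ψ f) Z) :
    obsLaw ψ n f = (obsLaw ψ n 0).withDensity
      fun x => ENNReal.ofReal (Real.exp (n * (Z x - ‖f‖ ^ 2 / 2))) := by
  have hs := hasSum_coeffs_sq ψ f
  have hv : (1 / (n : ℝ≥0)) ≠ 0 := by
    have : (n : ℝ≥0) ≠ 0 := by exact_mod_cast hn
    positivity
  rw [obsLaw_zero, obsLaw, infinitePi_gaussianReal_eq_withDensity hv e hs.summable hZ, hs.tsum_eq]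
  congr 1
  ext x
  congr 2
  push_cast
  rw [div_div_eq_mul_div, div_one, mul_comm]

theorem likelihood_ae_eq {e : ℕ ≃ WaveletIndex} {f : L2Unit}
    {Z : (WaveletIndex → ℝ) → ℝ} (hZm : Measurable Z)
    (hZ : IsLinearLimit (1 / (n : ℝ≥0)) e (coeffs ψ f) Z) :
    likelihood ψ n f =ᵐ[obsLaw ψ n 0]
      fun x => ENNReal.ofReal (Real.exp (n * (Z x - ‖f‖ ^ 2 / 2))) := by
  have h1 : likelihood ψ n f =ᵐ[obsLaw ψ n 0] (obsLaw ψ n f).rnDeriv (obsLaw ψ n 0) :=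
    Kernel.rnDeriv_eq_rnDeriv_measure (κ := obsKernel ψ n)
      (η := Kernel.const L2Unit (obsLaw ψ n 0)) (a := f)
  refine h1.trans ?_
  rw [obsLaw_eq_withDensity_exp ψ hn hZ]
  exact Measure.rnDeriv_withDensity _ (by fun_prop)

theorem exists_isLinearLimit_coeffs (e : ℕ ≃ WaveletIndex) (f : L2Unit) :
    ∃ Z : (WaveletIndex → ℝ) → ℝ, Measurable Z ∧
      IsLinearLimit (1 / (n : ℝ≥0)) e (coeffs ψ f) Z := by
  refine exists_isLinearLimit ?_ e (hasSum_coeffs_sq ψ f).summable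
  have : (n : ℝ≥0) ≠ 0 := by exact_mod_cast hn
  positivity

theorem likelihood_pos_lt_top (f : L2Unit) :
    ∀ᵐ x ∂(obsLaw ψ n 0), likelihood ψ n f x ≠ 0 ∧ likelihood ψ n f x ≠ ∞ := by
  obtain ⟨e⟩ := nonempty_equiv_waveletIndex
  obtain ⟨Z, hZm, hZ⟩ := exists_isLinearLimit_coeffs ψ hn e f
  filter_upwards [likelihood_ae_eq ψ hn hZm hZ] with x hx
  rw [hx]
  exact ⟨by simp [Real.exp_pos], ENNReal.ofReal_ne_top⟩

theorem obsLaw_eq_withDensity_likelihood (f : L2Unit) :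
    obsLaw ψ n f = (obsLaw ψ n 0).withDensity (likelihood ψ n f) := by
  obtain ⟨e⟩ := nonempty_equiv_waveletIndex
  obtain ⟨Z, hZm, hZ⟩ := exists_isLinearLimit_coeffs ψ hn e f
  rw [withDensity_congr_ae (likelihood_ae_eq ψ hn hZm hZ), ← obsLaw_eq_withDensity_exp ψ hn hZ]

/-- Up to a constant, `p_f^s p_g^(1-s)` is the likelihood at `u = s f + (1-s) g`, which integrates
to one; the constant is the defect in `‖u‖² = s‖f‖² + (1-s)‖g‖² - s(1-s)‖f-g‖²`. No sign or size
condition on `s` enters, which permits `s = -ρ`. -/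
theorem lintegral_likelihood_rpow_mul_rpow (f g : L2Unit) (s : ℝ) :
    ∫⁻ x, likelihood ψ n f x ^ s * likelihood ψ n g x ^ (1 - s) ∂(obsLaw ψ n 0)
      = ENNReal.ofReal (Real.exp (-(n * (s * (1 - s)) / 2 * ‖f - g‖ ^ 2))) := by
  obtain ⟨e⟩ := nonempty_equiv_waveletIndex
  obtain ⟨Z, hZm, hZ⟩ := exists_isLinearLimit_coeffs ψ hn e f
  obtain ⟨W, hWm, hW⟩ := exists_isLinearLimit_coeffs ψ hn e g
  set u := s • f + (1 - s) • g
  have hU : IsLinearLimit (1 / (n : ℝ≥0)) e (coeffs ψ u) (fun x => s * Z x + (1 - s) * W x) := by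
    rw [coeffs_lincomb]; exact hZ.lincomb hW s (1 - s)
  have hnorm : ‖u‖ ^ 2 = s * ‖f‖ ^ 2 + (1 - s) * ‖g‖ ^ 2 - s * (1 - s) * ‖f - g‖ ^ 2 := by
    rw [norm_add_sq_real, norm_sub_sq_real, norm_smul, norm_smul, inner_smul_left,
      inner_smul_right, mul_pow, mul_pow, Real.norm_eq_abs, Real.norm_eq_abs, sq_abs, sq_abs]
    simp only [conj_trivial]
    ring
  have hone : ∫⁻ x, ENNReal.ofReal (Real.exp (n * (s * Z x + (1 - s) * W x - ‖u‖ ^ 2 / 2)))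
      ∂(obsLaw ψ n 0) = 1 := by
    have := obsLaw_eq_withDensity_exp ψ hn hU
    rw [← setLIntegral_univ, ← withDensity_apply _ MeasurableSet.univ, ← this, measure_univ]
  have hpt : ∀ᵐ x ∂(obsLaw ψ n 0), likelihood ψ n f x ^ s * likelihood ψ n g x ^ (1 - s)
      = ENNReal.ofReal (Real.exp (n * (s * Z x + (1 - s) * W x - ‖u‖ ^ 2 / 2)))
        * ENNReal.ofReal (Real.exp (-(n * (s * (1 - s)) / 2 * ‖f - g‖ ^ 2))) := by
    filter_upwards [likelihood_ae_eq ψ hn hZm hZ, likelihood_ae_eq ψ hn hWm hW] with x hx hy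
    rw [hx, hy, ENNReal.ofReal_rpow_of_pos (Real.exp_pos _),
      ENNReal.ofReal_rpow_of_pos (Real.exp_pos _), ← Real.exp_mul, ← Real.exp_mul,
      ← ENNReal.ofReal_mul (Real.exp_pos _).le, ← ENNReal.ofReal_mul (Real.exp_pos _).le,
      ← Real.exp_add, ← Real.exp_add, hnorm]
    congr 2
    ring
  rw [lintegral_congr_ae hpt, lintegral_mul_const _ (by fun_prop), hone, one_mul]

end likelihood

theorem measurable_likelihood (ψ : DoubleIndexBasis) (n : ℕ) :
    Measurable (Function.uncurry (likelihood ψ n)) :=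
  Kernel.measurable_rnDeriv _ _

/-! ### Contraction of tempered posteriors under a prior mass bound -/

/-- Cauchy–Schwarz applied to `1 = p^(ρ/2) * p^(-ρ/2)`. It bounds the reciprocal of the normalising
constant by an integral of `p^(-ρ)`, whose expectation is explicit. -/
theorem sq_measure_le_lintegral_rpow_mul {α : Type*} [MeasurableSpace α] {μ : Measure α}
    {p : α → ℝ≥0∞} (hp : Measurable p) (hpos : ∀ᵐ a ∂μ, p a ≠ 0 ∧ p a ≠ ∞) (ρ : ℝ) (A : Set α) :
    μ A ^ 2 ≤ (∫⁻ a in A, p a ^ ρ ∂μ) * ∫⁻ a in A, p a ^ (-ρ) ∂μ := by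
  have h := ENNReal.lintegral_mul_le_Lp_mul_Lq (μ.restrict A) Real.HolderConjugate.two_two
    (f := fun a => p a ^ (ρ / 2)) (g := fun a => p a ^ (-(ρ / 2)))
    (hp.pow_const _).aemeasurable (hp.pow_const _).aemeasurable
  have h1 : ∫⁻ a in A, ((fun a => p a ^ (ρ / 2)) * fun a => p a ^ (-(ρ / 2))) a ∂μ = μ A := by
    rw [← setLIntegral_one]
    refine lintegral_congr_ae (ae_restrict_of_ae (hpos.mono fun a ha => ?_))
    simp only [Pi.mul_apply]
    rw [← ENNReal.rpow_add _ _ ha.1 ha.2, add_neg_cancel, ENNReal.rpow_zero]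
  rw [h1] at h
  simp only [← ENNReal.rpow_mul] at h
  have e1 : ρ / 2 * 2 = ρ := by ring
  have e2 : -(ρ / 2) * 2 = -ρ := by ring
  rw [e1, e2] at h
  calc μ A ^ 2 ≤ ((∫⁻ a in A, p a ^ ρ ∂μ) ^ (1 / 2 : ℝ) *
        (∫⁻ a in A, p a ^ (-ρ) ∂μ) ^ (1 / 2 : ℝ)) ^ 2 := by gcongr
    _ = _ := by
      rw [mul_pow, ← ENNReal.rpow_natCast, ← ENNReal.rpow_natCast, ← ENNReal.rpow_mul,
        ← ENNReal.rpow_mul]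
      norm_num

/-- The expected tempered posterior mass of the complement of a ball of radius `T` is controlled
by the prior mass of a ball of radius `ε`. -/
theorem lintegral_temperedPosterior_le (ψ : DoubleIndexBasis) (prior : Measure L2Unit)
    [IsProbabilityMeasure prior] {n : ℕ} (hn : n ≠ 0) (f₀ : L2Unit) {ρ : ℝ} (hρ : 0 < ρ)
    (hρ1 : ρ < 1) {T ε : ℝ} (hT : 0 ≤ T)
    (hmass : prior {f | ‖f - f₀‖ ≤ ε} ≠ 0) :
    ∫⁻ x, temperedPosterior ψ prior ρ n x {f | T < ‖f - f₀‖} ∂(obsLaw ψ n f₀) ≤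
      (prior {f | ‖f - f₀‖ ≤ ε})⁻¹ ^ (1 / 2 : ℝ) * ENNReal.ofReal (Real.exp
        (n * (ρ * (1 + ρ)) / 4 * ε ^ 2 - n * (ρ * (1 - ρ)) / 4 * T ^ 2)) := by
  set P := obsLaw ψ n 0 with hP
  set A : Set L2Unit := {f | ‖f - f₀‖ ≤ ε} with hA
  set B : Set L2Unit := {f | T < ‖f - f₀‖} with hB
  have hAm : MeasurableSet A := (isClosed_le (by fun_prop) continuous_const).measurableSet
  have hBm : MeasurableSet B := (isOpen_lt continuous_const (by fun_prop)).measurableSet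
  have hpm := measurable_likelihood ψ n
  have hpm' : Measurable fun q : (WaveletIndex → ℝ) × L2Unit => likelihood ψ n q.2 q.1 :=
    hpm.comp measurable_swap
  have hp0 : Measurable (likelihood ψ n f₀) := hpm.comp measurable_prodMk_left
  have hpx : ∀ x, Measurable fun f => likelihood ψ n f x := fun x =>
    hpm.comp measurable_prodMk_right
  let N : (WaveletIndex → ℝ) → ℝ≥0∞ := fun x => ∫⁻ f in B, likelihood ψ n f x ^ ρ ∂prior
  let Q : (WaveletIndex → ℝ) → ℝ≥0∞ := fun x => ∫⁻ f in A, likelihood ψ n f x ^ (-ρ) ∂prior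
  have hN : Measurable N := (hpm'.pow_const ρ).lintegral_prod_right'
  have hQ : Measurable Q := (hpm'.pow_const (-ρ)).lintegral_prod_right'
  -- The exceptional null set of `x` depends on `f`; Fubini exchanges the two quantifiers.
  have hpos : ∀ᵐ x ∂P, ∀ᵐ f ∂prior, likelihood ψ n f x ≠ 0 ∧ likelihood ψ n f x ≠ ∞ := by
    have hms : MeasurableSet {q : L2Unit × (WaveletIndex → ℝ) |
        likelihood ψ n q.1 q.2 ≠ 0 ∧ likelihood ψ n q.1 q.2 ≠ ∞} :=
      (hpm (measurableSet_singleton 0)).compl.inter (hpm (measurableSet_singleton ∞)).compl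
    exact (Measure.ae_ae_comm hms).1 (ae_of_all _ fun f => likelihood_pos_lt_top ψ hn f)
  have hAtop : prior A ≠ ∞ := measure_ne_top _ _
  have hpt : ∀ᵐ x ∂P, likelihood ψ n f₀ x * temperedPosterior ψ prior ρ n x B ≤
      (prior A)⁻¹ * ((N x * likelihood ψ n f₀ x ^ (1 - ρ)) ^ (1 / 2 : ℝ) *
        (Q x * likelihood ψ n f₀ x ^ (1 + ρ)) ^ (1 / 2 : ℝ)) := by
    filter_upwards [hpos, likelihood_pos_lt_top ψ hn f₀] with x hx hx0
    set D := ∫⁻ f, likelihood ψ n f x ^ ρ ∂prior with hD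
    set q := likelihood ψ n f₀ x with hq
    have hND : N x / D ≤ 1 := by
      refine (ENNReal.div_le_div_right (setLIntegral_le_lintegral _ _) D).trans
        ENNReal.div_self_le_one
    have hsq : prior A ^ 2 ≤ D * Q x := (sq_measure_le_lintegral_rpow_mul (hpx x) hx ρ A).trans
      (by gcongr; exact setLIntegral_le_lintegral _ _)
    have hDinv : D⁻¹ ≤ (prior A)⁻¹ ^ 2 * Q x := by
      rcases eq_or_ne D ∞ with hD' | hD'
      · simp [hD']
      rcases eq_or_ne D 0 with hD0 | hD0
      · exfalso
        have h0 : ∫⁻ f in A, likelihood ψ n f x ^ ρ ∂prior = 0 :=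
          le_antisymm ((setLIntegral_le_lintegral _ _).trans hD0.le) bot_le
        have := sq_measure_le_lintegral_rpow_mul (hpx x) hx ρ A
        rw [h0, zero_mul] at this
        exact hmass (by simpa using this)
      rw [← ENNReal.inv_pow, ← ENNReal.div_eq_inv_mul,
        ENNReal.le_div_iff_mul_le (Or.inl (pow_ne_zero 2 hmass))
        (Or.inl (ENNReal.pow_ne_top hAtop)), mul_comm, ← div_eq_mul_inv]
      exact ENNReal.div_le_of_le_mul (by rwa [mul_comm] at hsq)
    -- A number in `[0, 1]` is below its square root; the root prepares Cauchy–Schwarz in `x`.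
    have h1 : temperedPosterior ψ prior ρ n x B ≤ (N x / D) ^ (1 / 2 : ℝ) := by
      change N x / D ≤ _
      calc N x / D = (N x / D) ^ (1 : ℝ) := (ENNReal.rpow_one _).symm
        _ ≤ _ := ENNReal.rpow_le_rpow_of_exponent_ge hND (by norm_num)
    -- The split gives `N` the exponents `ρ, 1 - ρ` and `Q` the exponents `-ρ, 1 + ρ`, each pair
    -- summing to one.
    have hqs : q = (q ^ (1 - ρ)) ^ (1 / 2 : ℝ) * (q ^ (1 + ρ)) ^ (1 / 2 : ℝ) := by
      rw [← ENNReal.mul_rpow_of_nonneg _ _ (by norm_num), ← ENNReal.rpow_add _ _ hx0.1 hx0.2,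
        ← ENNReal.rpow_mul]
      norm_num
    calc q * temperedPosterior ψ prior ρ n x B
        ≤ q * (N x * ((prior A)⁻¹ ^ 2 * Q x)) ^ (1 / 2 : ℝ) := by
          refine mul_le_mul_right (h1.trans ?_) q
          gcongr
          rw [div_eq_mul_inv]
          gcongr
      _ = q * ((prior A)⁻¹ * ((N x) ^ (1 / 2 : ℝ) * (Q x) ^ (1 / 2 : ℝ))) := by
          have : ((prior A)⁻¹ ^ 2) ^ (1 / 2 : ℝ) = (prior A)⁻¹ := by
            rw [← ENNReal.rpow_natCast, ← ENNReal.rpow_mul]; norm_num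
          rw [ENNReal.mul_rpow_of_nonneg _ _ (by norm_num),
            ENNReal.mul_rpow_of_nonneg _ _ (by norm_num), this]
          ring
      _ = _ := by
          nth_rw 1 [hqs]
          rw [ENNReal.mul_rpow_of_nonneg _ _ (by norm_num),
            ENNReal.mul_rpow_of_nonneg _ _ (by norm_num)]
          ring
  have hNint : ∫⁻ x, N x * likelihood ψ n f₀ x ^ (1 - ρ) ∂P ≤
      ENNReal.ofReal (Real.exp (-(n * (ρ * (1 - ρ)) / 2 * T ^ 2))) := by
    have h1 : ∀ x, N x * likelihood ψ n f₀ x ^ (1 - ρ) =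
        ∫⁻ f in B, likelihood ψ n f x ^ ρ * likelihood ψ n f₀ x ^ (1 - ρ) ∂prior := fun x =>
      (lintegral_mul_const _ ((hpx x).pow_const ρ)).symm
    simp_rw [h1]
    rw [lintegral_lintegral_swap (((hpm'.pow_const ρ).mul
      ((hp0.comp measurable_fst).pow_const (1 - ρ))).aemeasurable)]
    simp_rw [P, lintegral_likelihood_rpow_mul_rpow ψ hn]
    calc _ ≤ ∫⁻ f in B, ENNReal.ofReal (Real.exp (-(n * (ρ * (1 - ρ)) / 2 * T ^ 2))) ∂prior := by
          refine setLIntegral_mono' hBm fun f hf => ?_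
          have hf' : T < ‖f - f₀‖ := hf
          have h0 : 0 ≤ ρ * (1 - ρ) := mul_nonneg hρ.le (by linarith)
          gcongr
      _ ≤ _ := by
          rw [setLIntegral_const]
          exact mul_le_of_le_one_right' prob_le_one
  have hQint : ∫⁻ x, Q x * likelihood ψ n f₀ x ^ (1 + ρ) ∂P ≤
      ENNReal.ofReal (Real.exp (n * (ρ * (1 + ρ)) / 2 * ε ^ 2)) * prior A := by
    have h1 : ∀ x, Q x * likelihood ψ n f₀ x ^ (1 + ρ) =
        ∫⁻ f in A, likelihood ψ n f x ^ (-ρ) * likelihood ψ n f₀ x ^ (1 - -ρ) ∂prior := fun x => by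
      rw [sub_neg_eq_add]
      exact (lintegral_mul_const _ ((hpx x).pow_const (-ρ))).symm
    simp_rw [h1]
    rw [lintegral_lintegral_swap (((hpm'.pow_const (-ρ)).mul
      ((hp0.comp measurable_fst).pow_const (1 - -ρ))).aemeasurable)]
    simp_rw [P, lintegral_likelihood_rpow_mul_rpow ψ hn]
    rw [← setLIntegral_const]
    refine setLIntegral_mono' hAm fun f hf => ?_
    have hf' : ‖f - f₀‖ ≤ ε := hf
    have e1 : -(n * (-ρ * (1 - -ρ)) / 2 * ‖f - f₀‖ ^ 2) =
      n * (ρ * (1 + ρ)) / 2 * ‖f - f₀‖ ^ 2 := by ring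
    rw [e1]
    gcongr
  rw [obsLaw_eq_withDensity_likelihood ψ hn f₀]
  calc _ ≤ ∫⁻ x, likelihood ψ n f₀ x * temperedPosterior ψ prior ρ n x B ∂P :=
        lintegral_withDensity_le_lintegral_mul _ hp0 _
    _ ≤ ∫⁻ x, (prior A)⁻¹ * ((N x * likelihood ψ n f₀ x ^ (1 - ρ)) ^ (1 / 2 : ℝ) *
        (Q x * likelihood ψ n f₀ x ^ (1 + ρ)) ^ (1 / 2 : ℝ)) ∂P := lintegral_mono_ae hpt
    _ = (prior A)⁻¹ * ∫⁻ x, (N x * likelihood ψ n f₀ x ^ (1 - ρ)) ^ (1 / 2 : ℝ) *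
        (Q x * likelihood ψ n f₀ x ^ (1 + ρ)) ^ (1 / 2 : ℝ) ∂P :=
        lintegral_const_mul _ (by fun_prop)
    _ ≤ (prior A)⁻¹ * ((∫⁻ x, N x * likelihood ψ n f₀ x ^ (1 - ρ) ∂P) ^ (1 / 2 : ℝ) *
        (∫⁻ x, Q x * likelihood ψ n f₀ x ^ (1 + ρ) ∂P) ^ (1 / 2 : ℝ)) := by
        gcongr
        have h := ENNReal.lintegral_mul_le_Lp_mul_Lq P Real.HolderConjugate.two_two
          (f := fun x => (N x * likelihood ψ n f₀ x ^ (1 - ρ)) ^ (1 / 2 : ℝ))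
          (g := fun x => (Q x * likelihood ψ n f₀ x ^ (1 + ρ)) ^ (1 / 2 : ℝ))
          (by fun_prop) (by fun_prop)
        simp only [← ENNReal.rpow_mul] at h
        norm_num at h ⊢
        exact h
    _ ≤ (prior A)⁻¹ * ((ENNReal.ofReal (Real.exp (-(n * (ρ * (1 - ρ)) / 2 * T ^ 2)))) ^ (1 / 2 : ℝ)
        * (ENNReal.ofReal (Real.exp (n * (ρ * (1 + ρ)) / 2 * ε ^ 2)) * prior A) ^ (1 / 2 : ℝ)) := by
        gcongr
    _ = _ := by
        have h2 : (prior A)⁻¹ = (prior A)⁻¹ ^ (1 / 2 : ℝ) * (prior A)⁻¹ ^ (1 / 2 : ℝ) := by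
          rw [← ENNReal.rpow_add_of_nonneg _ _ (by norm_num) (by norm_num)]
          norm_num
        have h3 : (prior A)⁻¹ ^ (1 / 2 : ℝ) * (prior A) ^ (1 / 2 : ℝ) = 1 := by
          rw [← ENNReal.mul_rpow_of_nonneg _ _ (by norm_num),
            ENNReal.inv_mul_cancel hmass hAtop, ENNReal.one_rpow]
        have h4 : ∀ y : ℝ, ENNReal.ofReal (Real.exp y) ^ (1 / 2 : ℝ)
            = ENNReal.ofReal (Real.exp (y * (1 / 2))) := fun y => by
          rw [ENNReal.ofReal_rpow_of_pos (Real.exp_pos _), ← Real.exp_mul]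
        rw [ENNReal.mul_rpow_of_nonneg _ _ (by norm_num), h4, h4]
        nth_rw 1 [h2]
        calc _ = (prior A)⁻¹ ^ (1 / 2 : ℝ) * ((prior A)⁻¹ ^ (1 / 2 : ℝ) * (prior A) ^ (1 / 2 : ℝ))
              * (ENNReal.ofReal (Real.exp (-(n * (ρ * (1 - ρ)) / 2 * T ^ 2) * (1 / 2)))
              * ENNReal.ofReal (Real.exp (n * (ρ * (1 + ρ)) / 2 * ε ^ 2 * (1 / 2)))) := by ring
          _ = _ := by
            rw [h3, mul_one, ← ENNReal.ofReal_mul (Real.exp_pos _).le, ← Real.exp_add]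
            congr 3
            ring

/-! ### Heavy-tailed densities -/

namespace IsHeavyTailDensity

variable {h : ℝ → ℝ} {c₁ κ : ℝ} (hh : IsHeavyTailDensity h c₁ κ)
include hh

theorem apply_abs (x : ℝ) : h |x| = h x := by
  rcases abs_choice x with hx | hx <;> rw [hx]
  exact hh.symm x

theorem measurable : Measurable h := by
  have hg : Antitone fun x => h (max x 0) := fun x y hxy =>
    hh.anti (mem_Ici.2 (le_max_right _ _)) (mem_Ici.2 (le_max_right _ _)) (max_le_max_right 0 hxy)
  have : h = fun x => (fun y => h (max y 0)) |x| := by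
    ext x
    simp only [max_eq_left (abs_nonneg x), hh.apply_abs]
  rw [this]
  exact hg.measurable.comp measurable_id.abs

theorem exp_neg_le {x : ℝ} (hx : 0 ≤ x) :
    Real.exp (-(c₁ * (1 + Real.log (1 + x) ^ (1 + κ)))) ≤ h x := by
  have := hh.log_le x hx
  rw [one_div, Real.log_inv] at this
  rw [← Real.le_log_iff_exp_le (hh.pos x)]
  linarith

/-- Lower bound for the mass of small intervals. -/
theorem le_measure_abs_mul_sub_le {s a τ x : ℝ} (hs : 0 < s)
    (hx : (|a| + τ) / s ≤ x) :
    ENNReal.ofReal (2 * τ / s * h x) ≤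
      volume.withDensity (fun x => ENNReal.ofReal (h x)) {t | |s * t - a| ≤ τ} := by
  have hset : {t | |s * t - a| ≤ τ} = Metric.closedBall (a / s) (τ / s) := by
    ext t
    rw [mem_ofPred_eq, Metric.mem_closedBall, Real.dist_eq, le_div_iff₀ hs]
    nth_rw 3 [← abs_of_pos hs]
    rw [← abs_mul]
    congr! 2
    field_simp
  have hm : MeasurableSet {t | |s * t - a| ≤ τ} := by
    rw [hset]; exact measurableSet_closedBall
  rw [withDensity_apply _ hm]
  calc ENNReal.ofReal (2 * τ / s * h x)
      = ∫⁻ _ in {t | |s * t - a| ≤ τ}, ENNReal.ofReal (h x) := by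
        rw [setLIntegral_const, hset, Real.volume_closedBall,
          ← ENNReal.ofReal_mul (hh.pos x).le]
        congr 1
        ring
    _ ≤ _ := by
        refine setLIntegral_mono' hm fun t ht => ENNReal.ofReal_le_ofReal ?_
        have ht' : |s * t - a| ≤ τ := ht
        have h1 : |t| ≤ x := by
          refine le_trans ?_ hx
          rw [le_div_iff₀ hs]
          calc |t| * s = |s * t| := by rw [abs_mul, abs_of_pos hs, mul_comm]
            _ = |a + (s * t - a)| := by ring_nf
            _ ≤ |a| + |s * t - a| := abs_add_le _ _
            _ ≤ _ := by gcongr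
        rw [← hh.apply_abs t]
        exact hh.anti (abs_nonneg t) ((abs_nonneg t).trans h1) h1

theorem measure_lt_abs_le {c₂ : ℝ}
    (hprob : IsProbabilityMeasure (volume.withDensity fun x => ENNReal.ofReal (h x)))
    (htail : ∀ x : ℝ, 1 ≤ x → ∫ u in Ioi x, h u ≤ c₂ / x ^ 2) {y : ℝ} (hy : 1 ≤ y) :
    volume.withDensity (fun x => ENNReal.ofReal (h x)) {t | y < |t|}
      ≤ ENNReal.ofReal (2 * c₂ / y ^ 2) := by
  have hint : Integrable h := by
    refine ⟨hh.measurable.aestronglyMeasurable, ?_⟩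
    rw [hasFiniteIntegral_iff_ofReal (ae_of_all _ fun x => (hh.pos x).le)]
    have := hprob.measure_univ
    rw [withDensity_apply _ .univ, setLIntegral_univ] at this
    rw [this]; exact ENNReal.one_lt_top
  have hset : {t : ℝ | y < |t|} = Ioi y ∪ Iio (-y) := by
    ext t
    simp only [mem_ofPred_eq, lt_abs, mem_union, mem_Ioi, mem_Iio]
    constructor <;> rintro (h | h) <;> first | (left; linarith) | (right; linarith)
  have h1 : ∫⁻ u in Ioi y, ENNReal.ofReal (h u) ≤ ENNReal.ofReal (c₂ / y ^ 2) := by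
    rw [← ofReal_integral_eq_lintegral_ofReal hint.integrableOn
      (ae_of_all _ fun x => (hh.pos x).le)]
    exact ENNReal.ofReal_le_ofReal (htail y hy)
  have h2 : ∫⁻ u in Iio (-y), ENNReal.ofReal (h u) = ∫⁻ u in Ioi y, ENNReal.ofReal (h u) := by
    have hmp := Measure.measurePreserving_neg (volume : Measure ℝ)
    rw [← hmp.setLIntegral_comp_preimage measurableSet_Iio
      (by have := hh.measurable; fun_prop)]
    simp only [hh.symm, neg_preimage, neg_Iio, neg_neg]
  have hc : 0 ≤ c₂ / y ^ 2 := (integral_nonneg fun x => (hh.pos x).le).trans (htail y hy)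
  have hm : MeasurableSet {t : ℝ | y < |t|} := measurableSet_lt measurable_const measurable_id.abs
  rw [withDensity_apply _ hm, hset]
  calc _ ≤ _ := lintegral_union_le _ _ _
    _ ≤ ENNReal.ofReal (c₂ / y ^ 2) + ENNReal.ofReal (c₂ / y ^ 2) := by
        rw [h2]; gcongr
    _ = _ := by
        rw [← ENNReal.ofReal_add hc hc]
        congr 1
        ring

end IsHeavyTailDensity

/-! ### Product measures of boxes -/

/-- A union bound, written additively to avoid truncated subtraction in `ℝ≥0∞`. -/
theorem one_le_prod_add_sum {ι : Type*} (F : Finset ι) {p q : ι → ℝ≥0∞}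
    (hp : ∀ i ∈ F, p i ≤ 1) (hpq : ∀ i ∈ F, 1 ≤ p i + q i) :
    1 ≤ ∏ i ∈ F, p i + ∑ i ∈ F, q i := by
  classical
  induction F using Finset.induction_on with
  | empty => simp
  | insert i F hi ih =>
    rw [Finset.prod_insert hi, Finset.sum_insert hi]
    have ih' := ih (fun j hj => hp j (Finset.mem_insert_of_mem hj))
      (fun j hj => hpq j (Finset.mem_insert_of_mem hj))
    have hi' := hp i (Finset.mem_insert_self i F)
    calc 1 ≤ p i * 1 + q i := by rw [mul_one]; exact hpq i (Finset.mem_insert_self i F)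
      _ ≤ p i * (∏ j ∈ F, p j + ∑ j ∈ F, q j) + q i := by gcongr
      _ ≤ p i * ∏ j ∈ F, p j + 1 * ∑ j ∈ F, q j + q i := by rw [mul_add]; gcongr
      _ = _ := by rw [one_mul]; ring

/-- The indices in `S` pay a factor `m` each, and the union bound keeps probability at least `1/2`
for all the others. Every finite subproduct may be enlarged to contain `S`, since its factors are at
most one. -/
theorem le_infinitePi_pi_univ {ι : Type*} [Countable ι] {X : ι → Type*}
    [∀ i, MeasurableSpace (X i)] (μ : ∀ i, Measure (X i)) [∀ i, IsProbabilityMeasure (μ i)]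
    {t : ∀ i, Set (X i)} (ht : ∀ i, MeasurableSet (t i)) (S : Finset ι) {m : ℝ≥0∞}
    (hS : ∀ i ∈ S, m ≤ μ i (t i)) {q : ι → ℝ≥0∞} (hq : ∀ i ∉ S, μ i (t i)ᶜ ≤ q i)
    (hsum : ∑' i, q i ≤ 1 / 2) :
    m ^ S.card * (1 / 2) ≤ Measure.infinitePi μ (Set.univ.pi t) := by
  classical
  rw [Measure.infinitePi_pi_univ _ ht, ENNReal.tprod_eq_iInf_prod fun i => prob_le_one]
  refine le_iInf fun F => ?_
  have hF : ∏ i ∈ F ∪ S, μ i (t i) ≤ ∏ i ∈ F, μ i (t i) :=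
    Finset.prod_le_prod_of_subset_of_le_one' Finset.subset_union_left fun i _ _ => prob_le_one
  refine le_trans ?_ hF
  rw [← Finset.prod_sdiff (Finset.subset_union_right : S ⊆ F ∪ S), mul_comm]
  gcongr
  · have h1 := one_le_prod_add_sum ((F ∪ S) \ S) (p := fun i => μ i (t i)) (q := q)
      (fun i _ => prob_le_one) (fun i hi => by
        have := hq i (Finset.mem_sdiff.1 hi).2
        calc 1 = μ i (t i) + μ i (t i)ᶜ := (prob_add_prob_compl (ht i)).symm
          _ ≤ _ := by gcongr)
    have h2 : ∑ i ∈ (F ∪ S) \ S, q i ≤ 1 / 2 := (ENNReal.sum_le_tsum _).trans hsum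
    have h3 : (1 : ℝ≥0∞) ≤ ∏ i ∈ (F ∪ S) \ S, μ i (t i) + 1 / 2 := h1.trans (by gcongr)
    calc (1 / 2 : ℝ≥0∞) = 1 - 1 / 2 := by simp
      _ ≤ _ := tsub_le_iff_right.2 h3
  · rw [← Finset.prod_const]
    exact Finset.prod_le_prod' hS

/-! ### Wavelet index sums -/

theorem hasSum_inv_four_pow_waveletIndex :
    HasSum (fun i : WaveletIndex => (1 / 4 : ℝ) ^ i.1) 2 := by
  have hfib : ∀ l : ℕ, HasSum (fun _ : Fin (2 ^ l) => (1 / 4 : ℝ) ^ l) ((1 / 2) ^ l) := fun l => by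
    convert hasSum_fintype (fun _ : Fin (2 ^ l) => (1 / 4 : ℝ) ^ l)
    simp only [Finset.sum_const, Finset.card_univ, Fintype.card_fin, nsmul_eq_mul]
    push_cast
    rw [← mul_pow]
    norm_num
  have hs : Summable fun i : WaveletIndex => (1 / 4 : ℝ) ^ i.1 := by
    rw [summable_sigma_of_nonneg fun i => by positivity]
    refine ⟨fun l => (hfib l).summable, ?_⟩
    simp only [(hfib _).tsum_eq]
    exact summable_geometric_two
  exact HasSum.sigma_of_hasSum hasSum_geometric_two hfib hs

theorem summable_and_tsum_le_of_mem_besovBall {ψ : DoubleIndexBasis} {β r L : ℝ} {f : L2Unit}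
    (hf : f ∈ besovBall ψ β r L) :
    Summable (fun i : WaveletIndex =>
      (2 : ℝ) ^ (r * i.1 * (β + 1 / 2 - 1 / r)) * |coeffs ψ f i| ^ r) ∧
    ∑' i : WaveletIndex, (2 : ℝ) ^ (r * i.1 * (β + 1 / 2 - 1 / r)) * |coeffs ψ f i| ^ r ≤ L ^ r := by
  set g : WaveletIndex → ℝ := fun i =>
    (2 : ℝ) ^ (r * i.1 * (β + 1 / 2 - 1 / r)) * |coeffs ψ f i| ^ r
  have hg : ∀ i, 0 ≤ g i := fun i => by positivity
  have h1 : ∑' i, ENNReal.ofReal (g i) < ENNReal.ofReal (L ^ r) := by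
    rw [ENNReal.tsum_sigma']
    refine lt_of_le_of_lt (le_of_eq (tsum_congr fun l => ?_)) hf
    rw [tsum_fintype, ← ENNReal.ofReal_sum_of_nonneg fun k _ => hg _, Finset.mul_sum]
  have hs : Summable g := by
    have := ENNReal.summable_toReal (h1.trans ENNReal.ofReal_lt_top).ne
    simpa only [ENNReal.toReal_ofReal (hg _)] using this
  refine ⟨hs, ?_⟩
  rw [← ENNReal.ofReal_tsum_of_nonneg hg hs] at h1
  exact ((ENNReal.ofReal_lt_ofReal_iff_of_nonneg (tsum_nonneg hg)).1 h1).le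

/-- Parseval. The summable majorant also forces the random series to converge, so that `otSeries` is
its true sum and not the default value of `tsum`. -/
theorem norm_otSeries_sub_sq_le {ψ : DoubleIndexBasis} {f₀ : L2Unit} {ζ : WaveletIndex → ℝ}
    {u : WaveletIndex → ℝ} {U : ℝ} (hu : HasSum u U)
    (h : ∀ i, (otScale i.1 * ζ i - coeffs ψ f₀ i) ^ 2 ≤ u i) :
    ‖otSeries ψ ζ - f₀‖ ^ 2 ≤ U := by
  set b : WaveletIndex → ℝ := fun i => otScale i.1 * ζ i - coeffs ψ f₀ i
  have hb : Summable fun i => b i ^ 2 :=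
    Summable.of_nonneg_of_le (fun i => sq_nonneg _) h hu.summable
  have hmem : Memℓp b 2 := by
    refine memℓp_gen ?_
    simpa using hb
  let c : lp (fun _ : WaveletIndex => ℝ) 2 := ⟨b, hmem⟩
  have h1 : HasSum (fun i => b i • ψ i) (ψ.repr.symm c) := ψ.hasSum_repr_symm c
  have h2 : HasSum (fun i => coeffs ψ f₀ i • ψ i) f₀ := by
    have := ψ.hasSum_repr f₀
    simpa only [HilbertBasis.repr_apply_apply, coeffs] using this
  have h3 : otSeries ψ ζ = ψ.repr.symm c + f₀ := by
    refine HasSum.tsum_eq ?_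
    refine (h1.add h2).congr_fun fun i => ?_
    rw [← add_smul]
    simp [b]
  have h4 : coeffs ψ (ψ.repr.symm c) = b := by
    ext i
    rw [coeffs, ← HilbertBasis.repr_apply_apply, LinearIsometryEquiv.apply_symm_apply]
  rw [h3, add_sub_cancel_right, ← (hasSum_coeffs_sq ψ (ψ.repr.symm c)).tsum_eq, h4, ← hu.tsum_eq]
  exact hb.tsum_le_tsum h hu.summable

/-! ### Significant coefficients of Besov functions -/

/-- With `N = n^(1/(2β+1))` and `γ = β + 1/2 - 1/r > 0` one has `n^(r/2) = N * N^(rγ)`, and `N^(rγ)`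
is at most the Besov weight as soon as `N ≤ 2^l`. -/
theorem rpow_mul_sqrt_le {n β r : ℝ} (hn : 1 ≤ n) (hβ : 0 < β) (hr : 1 ≤ r)
    (hβr : 1 / r - 1 / 2 < β) {l : ℕ} (hl : n ^ (1 / (2 * β + 1)) ≤ (2 : ℝ) ^ l) (a : ℝ) :
    (|a| * √n) ^ r ≤ n ^ (1 / (2 * β + 1)) *
      ((2 : ℝ) ^ (r * l * (β + 1 / 2 - 1 / r)) * |a| ^ r) := by
  have hn0 : 0 < n := by linarith
  have hN0 : 0 < n ^ (1 / (2 * β + 1)) := by positivity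
  have hγ : 0 < β + 1 / 2 - 1 / r := by linarith
  have h1 : √n ^ r = n ^ (1 / (2 * β + 1)) *
      (n ^ (1 / (2 * β + 1))) ^ (r * (β + 1 / 2 - 1 / r)) := by
    rw [Real.sqrt_eq_rpow, ← Real.rpow_mul hn0.le, ← Real.rpow_mul hn0.le, ← Real.rpow_add hn0]
    congr 1
    field_simp
    ring
  have h2 : (2 : ℝ) ^ (r * l * (β + 1 / 2 - 1 / r))
      = ((2 : ℝ) ^ l) ^ (r * (β + 1 / 2 - 1 / r)) := by
    rw [← Real.rpow_natCast, ← Real.rpow_mul (by norm_num)]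
    congr 1
    ring
  rw [Real.mul_rpow (abs_nonneg a) (Real.sqrt_nonneg n), h1, h2]
  have h3 : (n ^ (1 / (2 * β + 1))) ^ (r * (β + 1 / 2 - 1 / r)) ≤
      ((2 : ℝ) ^ l) ^ (r * (β + 1 / 2 - 1 / r)) := by
    apply Real.rpow_le_rpow hN0.le hl
    positivity
  have h4 : 0 ≤ |a| ^ r := by positivity
  calc _ = n ^ (1 / (2 * β + 1)) *
      ((n ^ (1 / (2 * β + 1))) ^ (r * (β + 1 / 2 - 1 / r)) * |a| ^ r) := by ring
    _ ≤ _ := by gcongr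

/-- The levels with `2^l ≤ N` hold at most `2N` indices. Above them, each coefficient exceeding
`n^(-1/2)` contributes at least `1/N` to the Besov sum, so there are at most `L^r N` of these. -/
theorem exists_finset_significant {ψ : DoubleIndexBasis} {n β r L : ℝ} {f : L2Unit}
    (hf : f ∈ besovBall ψ β r L) (hn : 1 ≤ n) (hβ : 0 < β) (hr : 1 ≤ r)
    (hβr : 1 / r - 1 / 2 < β) :
    ∃ S : Finset WaveletIndex, (S.card : ℝ) ≤ (2 + L ^ r) * n ^ (1 / (2 * β + 1)) ∧
      (∀ i ∈ S, (2 : ℝ) ^ i.1 ≤ n ^ (1 / (2 * β + 1)) ∨ 1 < |coeffs ψ f i| * √n) ∧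
      ∀ i ∉ S, n ^ (1 / (2 * β + 1)) < (2 : ℝ) ^ i.1 ∧ |coeffs ψ f i| * √n ≤ 1 := by
  classical
  obtain ⟨hs, hG⟩ := summable_and_tsum_le_of_mem_besovBall hf
  set g : WaveletIndex → ℝ := fun i =>
    (2 : ℝ) ^ (r * i.1 * (β + 1 / 2 - 1 / r)) * |coeffs ψ f i| ^ r with hg
  have hg0 : ∀ i, 0 ≤ g i := fun i => by positivity
  set N := n ^ (1 / (2 * β + 1)) with hN
  have hN1 : 1 ≤ N := Real.one_le_rpow hn (by positivity)
  have hN0 : 0 < N := by linarith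
  obtain ⟨J, hJ1, hJ2⟩ := exists_nat_pow_near hN1 (by norm_num : (1 : ℝ) < 2)
  let A : Set WaveletIndex := {i | N < (2 : ℝ) ^ i.1 ∧ 1 < |coeffs ψ f i| * √n}
  have hA : ∀ i ∈ A, 1 ≤ N * g i := fun i hi =>
    (Real.one_le_rpow hi.2.le (by linarith)).trans
      (rpow_mul_sqrt_le hn hβ hr hβr hi.1.le _)
  have hfin : A.Finite := by
    have h1 : ∀ᶠ i in cofinite, N * g i < 1 :=
      (hs.mul_left N).tendsto_cofinite_zero.eventually_lt_const one_pos
    refine Set.Finite.subset h1 fun i hi => ?_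
    have := hA i hi
    simpa using this
  have hcardA : (hfin.toFinset.card : ℝ) ≤ L ^ r * N := by
    calc (hfin.toFinset.card : ℝ) = ∑ i ∈ hfin.toFinset, (1 : ℝ) := by simp
      _ ≤ ∑ i ∈ hfin.toFinset, N * g i :=
          Finset.sum_le_sum fun i hi => hA i (hfin.mem_toFinset.1 hi)
      _ = N * ∑ i ∈ hfin.toFinset, g i := (Finset.mul_sum _ _ _).symm
      _ ≤ N * L ^ r := by
          gcongr
          exact (hs.sum_le_tsum _ fun i _ => hg0 i).trans hG
      _ = _ := mul_comm _ _
  let S₀ : Finset WaveletIndex := (Finset.range (J + 1)).sigma fun _ => Finset.univ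
  have hcard0 : (S₀.card : ℝ) ≤ 2 * N := by
    have h1 : S₀.card = ∑ l ∈ Finset.range (J + 1), 2 ^ l := by
      simp [S₀, Finset.card_sigma]
    have h2 : S₀.card ≤ 2 ^ (J + 1) := by
      rw [h1]
      exact (Nat.geomSum_lt (le_refl 2) fun k hk => Finset.mem_range.1 hk).le
    calc (S₀.card : ℝ) ≤ ((2 ^ (J + 1) : ℕ) : ℝ) := by exact_mod_cast h2
      _ = 2 * 2 ^ J := by push_cast; ring
      _ ≤ _ := by gcongr
  have hmem0 : ∀ i : WaveletIndex, i ∈ S₀ ↔ i.1 ≤ J := fun i => by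
    simp [S₀]
  have hnot : ∀ i : WaveletIndex, i ∉ S₀ → N < (2 : ℝ) ^ i.1 := fun i hi => by
    rw [hmem0, not_le] at hi
    exact hJ2.trans_le (pow_le_pow_right₀ (by norm_num) hi)
  refine ⟨S₀ ∪ hfin.toFinset, ?_, fun i hi => ?_, fun i hi => ?_⟩
  · calc ((S₀ ∪ hfin.toFinset).card : ℝ) ≤ S₀.card + hfin.toFinset.card := by
          exact_mod_cast Finset.card_union_le _ _
      _ ≤ _ := by linarith
  · rcases Finset.mem_union.1 hi with h | h
    · left
      exact (pow_le_pow_right₀ (by norm_num) ((hmem0 i).1 h)).trans hJ1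
    · right
      exact (hfin.mem_toFinset.1 h).2
  · rw [Finset.mem_union, not_or] at hi
    have h1 := hnot i hi.1
    refine ⟨h1, ?_⟩
    by_contra hcon
    exact hi.2 (hfin.mem_toFinset.2 ⟨h1, not_le.1 hcon⟩)

theorem norm_otSeries_sub_le {ψ : DoubleIndexBasis} {n β r L : ℝ} {f : L2Unit}
    (hf : f ∈ besovBall ψ β r L) (hn : 1 ≤ n) (hβ : 0 < β) (hr : r ∈ Icc (1 : ℝ) 2)
    (hβr : 1 / r - 1 / 2 < β) {S : Finset WaveletIndex}
    (hcard : (S.card : ℝ) ≤ (2 + L ^ r) * n ^ (1 / (2 * β + 1)))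
    (hS : ∀ i ∉ S, n ^ (1 / (2 * β + 1)) < (2 : ℝ) ^ i.1 ∧ |coeffs ψ f i| * √n ≤ 1)
    {ζ : WaveletIndex → ℝ} (h1 : ∀ i ∈ S, |otScale i.1 * ζ i - coeffs ψ f i| ≤ (√n)⁻¹)
    (h2 : ∀ i ∉ S, |otScale i.1 * ζ i| ≤ (√n)⁻¹ * (1 / 2) ^ i.1) :
    ‖otSeries ψ ζ - f‖ ≤ √((6 + 3 * L ^ r) * n ^ (1 / (2 * β + 1)) / n) := by
  classical
  obtain ⟨hs, hG⟩ := summable_and_tsum_le_of_mem_besovBall hf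
  set g : WaveletIndex → ℝ := fun i =>
    (2 : ℝ) ^ (r * i.1 * (β + 1 / 2 - 1 / r)) * |coeffs ψ f i| ^ r with hg
  have hg0 : ∀ i, 0 ≤ g i := fun i => by positivity
  have hkey := fun (i : WaveletIndex) hi =>
    rpow_mul_sqrt_le hn hβ hr.1 hβr (l := i.1) hi (coeffs ψ f i)
  set N := n ^ (1 / (2 * β + 1)) with hN
  have hN1 : 1 ≤ N := Real.one_le_rpow hn (by positivity)
  have hn0 : 0 < n := by linarith
  have hsq : √n ^ 2 = n := Real.sq_sqrt hn0.le
  have hsq0 : 0 < √n := Real.sqrt_pos.2 hn0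
  -- Error budget: `1/n` on `S`; off `S`, `(x - y)² ≤ 2x² + 2y²`, where `(|f_i|√n)² ≤ (|f_i|√n)^r`
  -- because the base is at most one and `r ≤ 2`. The total `(2 + L^r)N + 2NL^r + 4` is at most `(6
  -- + 3L^r)N`.
  let u : WaveletIndex → ℝ := fun i =>
    ((if i ∈ S then 1 else 0) + 2 * N * g i + 2 * (1 / 4) ^ i.1) / n
  have hu : HasSum u ((S.card + 2 * N * ∑' i, g i + 2 * 2) / n) := by
    have hind : HasSum (fun i => if i ∈ S then (1 : ℝ) else 0) S.card := by
      have : HasSum (fun i => if i ∈ S then (1 : ℝ) else 0) (∑ i ∈ S, if i ∈ S then 1 else 0) :=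
        hasSum_sum_of_ne_finset_zero fun i hi => if_neg hi
      simpa using this
    exact ((hind.add (hs.hasSum.mul_left _)).add
      (hasSum_inv_four_pow_waveletIndex.mul_left 2)).div_const n
  refine Real.le_sqrt_of_sq_le ((norm_otSeries_sub_sq_le hu fun i => ?_).trans ?_)
  · by_cases hi : i ∈ S
    · have h3 : (otScale i.1 * ζ i - coeffs ψ f i) ^ 2 ≤ 1 / n := by
        rw [← sq_abs]
        calc _ ≤ ((√n)⁻¹) ^ 2 := by gcongr; exact h1 i hi
          _ = 1 / n := by rw [inv_pow, hsq, one_div]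
      refine h3.trans ?_
      simp only [u, if_pos hi]
      have := hg0 i
      gcongr
      have : 0 ≤ 2 * N * g i + 2 * (1 / 4 : ℝ) ^ i.1 := by positivity
      linarith
    · obtain ⟨h3, h4⟩ := hS i hi
      have h5 : (|coeffs ψ f i| * √n) ^ 2 ≤ N * g i := by
        refine le_trans ?_ (hkey i h3.le)
        have h0 : 0 ≤ |coeffs ψ f i| * √n := by positivity
        rw [← Real.rpow_natCast]
        rcases h0.eq_or_lt with h0 | h0
        · rw [← h0, Real.zero_rpow (by norm_num), Real.zero_rpow (by linarith [hr.1])]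
        · exact Real.rpow_le_rpow_of_exponent_ge h0 h4 (by exact_mod_cast hr.2)
      rw [mul_pow, sq_abs, hsq] at h5
      have h6 : (otScale i.1 * ζ i) ^ 2 * n ≤ (1 / 4) ^ i.1 := by
        rw [← sq_abs (otScale i.1 * ζ i)]
        calc _ ≤ ((√n)⁻¹ * (1 / 2) ^ i.1) ^ 2 * n := by gcongr; exact h2 i hi
          _ = (1 / 4) ^ i.1 := by
            rw [mul_pow, inv_pow, hsq, ← pow_mul, mul_comm i.1 2, pow_mul]
            field_simp
            norm_num
      simp only [u, if_neg hi]
      rw [le_div_iff₀ hn0]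
      nlinarith [mul_nonneg (sq_nonneg (otScale i.1 * ζ i + coeffs ψ f i)) hn0.le]
  · gcongr
    have h7 : N * ∑' i, g i ≤ N * L ^ r := by gcongr
    linarith

/-! ### Prior mass of small balls -/

/-- On the levels carrying significant coefficients, `l` is of order at most `log n`. -/
theorem exists_level_le_log {ψ : DoubleIndexBasis} {β r L : ℝ} {f : L2Unit}
    (hf : f ∈ besovBall ψ β r L) (hL : 0 < L) (hβ : 0 < β) (hr : 1 ≤ r)
    (hβr : 1 / r - 1 / 2 < β) :
    ∃ K : ℝ, ∀ n : ℝ, 1 ≤ Real.log n → 1 ≤ n → ∀ i : WaveletIndex,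
      ((2 : ℝ) ^ i.1 ≤ n ^ (1 / (2 * β + 1)) ∨ 1 < |coeffs ψ f i| * √n) →
        i.1 ≤ K * Real.log n := by
  obtain ⟨hs, hG⟩ := summable_and_tsum_le_of_mem_besovBall hf
  have hγ : 0 < β + 1 / 2 - 1 / r := by linarith
  set γ := β + 1 / 2 - 1 / r
  have hl2 : 0 < Real.log 2 := Real.log_pos (by norm_num)
  refine ⟨(Real.log 2)⁻¹ + (|Real.log L| + 1) / (γ * Real.log 2),
    fun n hlog hn i hi => ?_⟩
  have hn0 : 0 < n := by linarith
  rw [add_mul]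
  rcases hi with hi | hi
  · have h1 := Real.log_le_log (by positivity) hi
    rw [Real.log_pow, Real.log_rpow hn0] at h1
    have h2 : 1 / (2 * β + 1) * Real.log n ≤ 1 * Real.log n := by
      gcongr
      rw [div_le_one (by linarith)]
      linarith
    have h3 : (i.1 : ℝ) ≤ (Real.log 2)⁻¹ * Real.log n := by
      rw [inv_mul_eq_div, le_div_iff₀ hl2]
      linarith
    have : 0 ≤ (|Real.log L| + 1) / (γ * Real.log 2) * Real.log n := by positivity
    linarith
  -- One term of the Besov sum is at most `L^r`; with `|f_i| > n^(-1/2)` this forces `2^(lγ) < L√n`.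
  · have h1 : (2 : ℝ) ^ (r * i.1 * γ) * |coeffs ψ f i| ^ r ≤ L ^ r :=
      (hs.le_tsum i fun j _ => by positivity).trans hG
    have hsq0 : 0 < √n := Real.sqrt_pos.2 hn0
    have ha : 0 < |coeffs ψ f i| := by
      by_contra hcon
      have : |coeffs ψ f i| = 0 := le_antisymm (not_lt.1 hcon) (abs_nonneg _)
      rw [this, zero_mul] at hi
      linarith
    have h2 := Real.log_le_log (by positivity) h1
    rw [Real.log_mul (by positivity) (by positivity), Real.log_rpow (by norm_num),
      Real.log_rpow ha, Real.log_rpow hL] at h2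
    have h3 := Real.log_pos hi
    rw [Real.log_mul ha.ne' hsq0.ne', Real.log_sqrt hn0.le] at h3
    have h4 : i.1 * γ * Real.log 2 ≤ Real.log L + Real.log n / 2 := by
      have : r * (i.1 * γ * Real.log 2) ≤ r * (Real.log L + Real.log n / 2) := by nlinarith
      exact le_of_mul_le_mul_left this (by linarith)
    have h5 : (i.1 : ℝ) ≤ (|Real.log L| + 1) / (γ * Real.log 2) * Real.log n := by
      rw [div_mul_eq_mul_div, le_div_iff₀ (by positivity)]
      nlinarith [le_abs_self (Real.log L), abs_nonneg (Real.log L)]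
    have : 0 ≤ (Real.log 2)⁻¹ * Real.log n := by positivity
    linarith

theorem otScale_pos (l : ℕ) : 0 < otScale l := by unfold otScale; positivity

theorem log_inv_otScale (l : ℕ) : Real.log (otScale l)⁻¹ = l ^ 2 * Real.log 2 := by
  rw [otScale, Real.log_inv, Real.log_rpow (by norm_num)]
  ring

theorem otScale_le_one (l : ℕ) : otScale l ≤ 1 :=
  Real.rpow_le_one_of_one_le_of_nonpos (by norm_num) (neg_nonpos.2 (sq_nonneg _))

/-- The heavy tail acts here: `ζ` must reach points of size at most a constant times `2^(l²)`, of
logarithm `O(log² n)` since `l = O(log n)`, where `h` is at least `exp (-C (log² n)^(1+κ))`. -/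
theorem exists_exp_le_measure_coord {h : ℝ → ℝ} {c₁ κ : ℝ} (hc₁ : 0 < c₁) (hκ : 0 ≤ κ)
    (hh : IsHeavyTailDensity h c₁ κ) (R K : ℝ) :
    ∃ C : ℝ, 0 < C ∧ ∀ n : ℝ, 1 ≤ n → 1 ≤ Real.log n → ∀ l : ℕ, l ≤ K * Real.log n →
      ∀ a : ℝ, |a| ≤ R →
        ENNReal.ofReal (Real.exp (-(C * Real.log n ^ (2 + 2 * κ)))) ≤
          volume.withDensity (fun x => ENNReal.ofReal (h x)) {t | |otScale l * t - a| ≤ (√n)⁻¹} := by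
  set R' := |R| with hR'
  have hR0 : 0 ≤ R' := abs_nonneg R
  set D : ℝ := Real.log (R' + 2) + K ^ 2 * Real.log 2 with hD
  have hl2 : 0 < Real.log 2 := Real.log_pos (by norm_num)
  have hD0 : 0 ≤ D := by
    have : 0 ≤ Real.log (R' + 2) := Real.log_nonneg (by linarith)
    positivity
  -- The leading `1` pays for the interval width `n^(-1/2)`, the rest for the value of `h`.
  refine ⟨1 + c₁ * (1 + D ^ (1 + κ)), by positivity, fun n hn hlog l hl a ha => ?_⟩
  have hs := otScale_pos l
  have hn0 : 0 < n := by linarith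
  have hsq1 : 1 ≤ √n := Real.one_le_sqrt.2 hn
  have hτ : (√n)⁻¹ ≤ 1 := inv_le_one_of_one_le₀ hsq1
  have hinv : 1 ≤ (otScale l)⁻¹ := (one_le_inv₀ hs).2 (otScale_le_one l)
  set x := (R' + 1) * (otScale l)⁻¹ with hx
  have hx0 : 0 ≤ x := by positivity
  have hax : (|a| + (√n)⁻¹) / otScale l ≤ x := by
    rw [div_eq_mul_inv, hx]
    gcongr
    exact ha.trans (le_abs_self R)
  refine le_trans (ENNReal.ofReal_le_ofReal ?_) (hh.le_measure_abs_mul_sub_le hs hax)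
  have hlogx : Real.log (1 + x) ≤ D * Real.log n ^ 2 := by
    have h1 : 1 + x ≤ (R' + 2) * (otScale l)⁻¹ := by rw [hx]; nlinarith
    have h2 := Real.log_le_log (by positivity) h1
    rw [Real.log_mul (by positivity) (by positivity), log_inv_otScale] at h2
    have h3 : (l : ℝ) ^ 2 ≤ (K * Real.log n) ^ 2 := by gcongr
    have h4 : 1 ≤ Real.log n ^ 2 := one_le_pow₀ hlog
    have h5 : 0 ≤ Real.log (R' + 2) := Real.log_nonneg (by linarith)
    calc _ ≤ _ := h2
      _ ≤ Real.log (R' + 2) * Real.log n ^ 2 + (K * Real.log n) ^ 2 * Real.log 2 := by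
          gcongr
          exact le_mul_of_one_le_right h5 h4
      _ = _ := by rw [hD]; ring
  set Λ := Real.log n ^ (2 + 2 * κ) with hΛ
  have hpow : Real.log (1 + x) ^ (1 + κ) ≤ D ^ (1 + κ) * Λ := by
    calc _ ≤ (D * Real.log n ^ 2) ^ (1 + κ) := by
          apply Real.rpow_le_rpow (Real.log_nonneg (by linarith)) hlogx (by linarith)
      _ = _ := by
          rw [Real.mul_rpow hD0 (by positivity), ← Real.rpow_natCast,
            ← Real.rpow_mul (by linarith)]
          congr 2
          push_cast
          ring
  have hΛ1 : Real.log n ≤ Λ := by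
    calc Real.log n = Real.log n ^ (1 : ℝ) := (Real.rpow_one _).symm
      _ ≤ _ := Real.rpow_le_rpow_of_exponent_le hlog (by linarith)
  have hhx := hh.exp_neg_le hx0
  have hτexp : Real.exp (-Λ) ≤ (√n)⁻¹ := by
    rw [← Real.le_log_iff_exp_le (by positivity), Real.log_inv, Real.log_sqrt hn0.le]
    linarith
  calc Real.exp (-((1 + c₁ * (1 + D ^ (1 + κ))) * Λ))
      = Real.exp (-Λ) * Real.exp (-(c₁ * ((1 + D ^ (1 + κ)) * Λ))) := by
        rw [← Real.exp_add]; congr 1; ring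
    _ ≤ (√n)⁻¹ * Real.exp (-(c₁ * (1 + Real.log (1 + x) ^ (1 + κ)))) := by
        gcongr
        rw [add_mul, one_mul]
        linarith
    _ ≤ (√n)⁻¹ * h x := by gcongr
    _ ≤ 2 * (√n)⁻¹ / otScale l * h x := by
        have := hh.pos x
        gcongr
        rw [div_eq_mul_inv]
        have : 0 < (√n)⁻¹ := by positivity
        nlinarith

/-- The threshold for `ζ` is `y = n^(-1/2) 2^(-l) 2^(l²)`. As `n < 2^((2β+1)l)`, the quadratic
exponent makes the tail `2c₂/y²` smaller than `4^(-l)/4`, whose sum over all indices is `1/2`. -/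
theorem exists_measure_coord_compl_le {h : ℝ → ℝ} {c₁ c₂ κ : ℝ} (hc₂ : 0 < c₂)
    (hprob : IsProbabilityMeasure (volume.withDensity fun x => ENNReal.ofReal (h x)))
    (hh : IsHeavyTailDensity h c₁ κ)
    (htail : ∀ x : ℝ, 1 ≤ x → ∫ u in Ioi x, h u ≤ c₂ / x ^ 2) {β : ℝ} (hβ : 0 < β) :
    ∃ l₀ : ℕ, ∀ n : ℝ, 1 ≤ n → (2 : ℝ) ^ l₀ ≤ n ^ (1 / (2 * β + 1)) → ∀ l : ℕ,
      n ^ (1 / (2 * β + 1)) < (2 : ℝ) ^ l →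
        volume.withDensity (fun x => ENNReal.ofReal (h x))
          {t | |otScale l * t| ≤ (√n)⁻¹ * (1 / 2) ^ l}ᶜ
            ≤ ENNReal.ofReal (1 / 4 * (1 / 4) ^ l) := by
  -- The summand `8 * c₂` yields the tail bound and the summand `1` ensures `y ≥ 1`; `l ≥ b + β + 4`
  -- gives `b + 2l + (2β+1)l ≤ 2l² - 2l`.
  obtain ⟨b, hb⟩ := pow_unbounded_of_one_lt (1 + 8 * c₂) (by norm_num : (1 : ℝ) < 2)
  obtain ⟨l₀, hl₀⟩ := exists_nat_ge (b + β + 4)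
  refine ⟨l₀, fun n hn hNl l hl => ?_⟩
  have hn0 : 0 < n := by linarith
  have hl₀l : l₀ ≤ l := by
    by_contra hcon
    have := pow_le_pow_right₀ (by norm_num : (1 : ℝ) ≤ 2) (not_le.1 hcon).le
    linarith
  have hlr : (b : ℝ) + β + 4 ≤ l := hl₀.trans (by exact_mod_cast hl₀l)
  have hnl : n ≤ (2 : ℝ) ^ ((2 * β + 1) * (l : ℝ)) := by
    have h1 : n = (n ^ (1 / (2 * β + 1))) ^ (2 * β + 1) := by
      rw [← Real.rpow_mul hn0.le, one_div_mul_cancel (by positivity), Real.rpow_one]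
    have h2 : (2 : ℝ) ^ ((2 * β + 1) * (l : ℝ)) = ((2 : ℝ) ^ l) ^ (2 * β + 1) := by
      rw [← Real.rpow_natCast, ← Real.rpow_mul (by norm_num), mul_comm]
    rw [h2]
    nth_rw 1 [h1]
    exact Real.rpow_le_rpow (by positivity) hl.le (by positivity)
  have hs := otScale_pos l
  have hsq0 : 0 < √n := Real.sqrt_pos.2 hn0
  set y : ℝ := (√n)⁻¹ * (1 / 2) ^ l / otScale l with hy
  have hy0 : 0 < y := by positivity
  have hy2 : (1 + 8 * c₂) * 4 ^ l ≤ y ^ 2 := by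
    have h1 : y ^ 2 = n⁻¹ * (2 : ℝ) ^ (2 * (l : ℝ) ^ 2 - 2 * l) := by
      rw [hy, div_pow, mul_pow, inv_pow, Real.sq_sqrt hn0.le, otScale, mul_div_assoc]
      congr 1
      rw [← Real.rpow_natCast ((2 : ℝ) ^ (-((l : ℝ) ^ 2))), ← Real.rpow_mul (by norm_num),
        one_div, inv_pow, ← Real.rpow_natCast, ← Real.rpow_natCast, ← Real.rpow_neg (by norm_num),
        ← Real.rpow_mul (by norm_num), ← Real.rpow_sub (by norm_num)]
      congr 1
      push_cast
      ring
    have h4 : (4 : ℝ) ^ l = (2 : ℝ) ^ (2 * (l : ℝ)) := by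
      rw [Real.rpow_mul (by norm_num), ← Real.rpow_natCast]
      norm_num
    have h5 : (1 + 8 * c₂) ≤ (2 : ℝ) ^ (b : ℝ) := by
      rw [Real.rpow_natCast]; exact hb.le
    rw [h1, inv_mul_eq_div, le_div_iff₀ hn0, h4]
    calc (1 + 8 * c₂) * (2 : ℝ) ^ (2 * (l : ℝ)) * n
        ≤ (2 : ℝ) ^ (b : ℝ) * (2 : ℝ) ^ (2 * (l : ℝ)) * (2 : ℝ) ^ ((2 * β + 1) * (l : ℝ)) := by
          gcongr
      _ = (2 : ℝ) ^ ((b : ℝ) + 2 * l + (2 * β + 1) * l) := by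
          rw [← Real.rpow_add (by norm_num), ← Real.rpow_add (by norm_num)]
      _ ≤ _ := by
          apply Real.rpow_le_rpow_of_exponent_le (by norm_num)
          have hb0 : (0 : ℝ) ≤ b := Nat.cast_nonneg b
          nlinarith
  have h4l : (1 : ℝ) ≤ 4 ^ l := one_le_pow₀ (by norm_num)
  have hy1 : 1 ≤ y := by
    rw [← one_le_sq_iff₀ hy0.le]
    nlinarith
  have hset : {t | |otScale l * t| ≤ (√n)⁻¹ * (1 / 2) ^ l}ᶜ = {t | y < |t|} := by
    ext t
    rw [mem_compl_iff, mem_ofPred_eq, mem_ofPred_eq, not_le, hy, div_lt_iff₀ hs, abs_mul,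
      abs_of_pos hs, mul_comm |t|]
  rw [hset]
  refine (hh.measure_lt_abs_le hprob htail hy1).trans (ENNReal.ofReal_le_ofReal ?_)
  rw [div_le_iff₀ (by positivity)]
  calc 2 * c₂ = 1 / 4 * (1 / 4) ^ l * (8 * c₂ * 4 ^ l) := by
        rw [one_div_pow]; field_simp; norm_num
    _ ≤ _ := by gcongr; nlinarith

instance instIsProbabilityMeasureOtPrior (ψ : DoubleIndexBasis) (H : Measure ℝ)
    [IsProbabilityMeasure H] : IsProbabilityMeasure (otPrior ψ H) :=
  Measure.isProbabilityMeasure_map (measurable_otSeries ψ).aemeasurable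

/-- Lower bound for the prior mass of balls of squared radius of order `n ^ (1 / (2β+1)) / n`
around a Besov function. -/
theorem exists_exp_le_otPrior_ball (ψ : DoubleIndexBasis) {h : ℝ → ℝ} {c₁ c₂ κ : ℝ}
    (hprob : IsProbabilityMeasure (volume.withDensity fun x => ENNReal.ofReal (h x)))
    (hc₁ : 0 < c₁) (hc₂ : 0 < c₂) (hκ : 0 ≤ κ) (hh : IsHeavyTailDensity h c₁ κ)
    (htail : ∀ x : ℝ, 1 ≤ x → ∫ u in Ioi x, h u ≤ c₂ / x ^ 2)
    {β L r : ℝ} (hβ : 0 < β) (hL : 0 < L) (hr : r ∈ Icc (1 : ℝ) 2) (hβr : 1 / r - 1 / 2 < β)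
    {f : L2Unit} (hf : f ∈ besovBall ψ β r L) :
    ∃ C : ℝ, 0 < C ∧ ∀ᶠ n : ℕ in atTop,
      ENNReal.ofReal (Real.exp (-(C * Real.log n ^ (2 + 2 * κ) * (n : ℝ) ^ (1 / (2 * β + 1))))) ≤
        otPrior ψ (volume.withDensity fun x => ENNReal.ofReal (h x))
          {g | ‖g - f‖ ≤ √((6 + 3 * L ^ r) * (n : ℝ) ^ (1 / (2 * β + 1)) / n)} := by
  classical
  set H := volume.withDensity fun x => ENNReal.ofReal (h x) with hH
  obtain ⟨K, hK⟩ := exists_level_le_log hf hL hβ hr.1 hβr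
  obtain ⟨C, hC0, hC⟩ := exists_exp_le_measure_coord hc₁ hκ hh ‖f‖ K
  obtain ⟨l₀, hl₀⟩ := exists_measure_coord_compl_le hc₂ hprob hh htail hβ
  -- The cost `C` per index is multiplied by the bound on the cardinality of `S`; the final `+ 1`
  -- absorbs the factor `1/2`.
  refine ⟨C * (2 + L ^ r) + 1, by positivity, ?_⟩
  have hlog : ∀ᶠ n : ℕ in atTop, 1 ≤ Real.log n :=
    (Real.tendsto_log_atTop.comp tendsto_natCast_atTop_atTop).eventually_ge_atTop 1
  have hpow : ∀ᶠ n : ℕ in atTop, (2 : ℝ) ^ l₀ ≤ (n : ℝ) ^ (1 / (2 * β + 1)) :=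
    ((tendsto_rpow_atTop (by positivity : 0 < 1 / (2 * β + 1))).comp
      tendsto_natCast_atTop_atTop).eventually_ge_atTop _
  filter_upwards [hlog, hpow, eventually_ge_atTop 1] with n hlogn hpown hn1
  have hn : (1 : ℝ) ≤ n := by exact_mod_cast hn1
  obtain ⟨S, hcard, hS1, hS2⟩ := exists_finset_significant hf hn hβ hr.1 hβr
  have hball : MeasurableSet {g : L2Unit | ‖g - f‖ ≤
      √((6 + 3 * L ^ r) * (n : ℝ) ^ (1 / (2 * β + 1)) / n)} :=
    (isClosed_le (by fun_prop) continuous_const).measurableSet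
  rw [otPrior, Measure.map_apply (measurable_otSeries ψ) hball]
  let t : WaveletIndex → Set ℝ := fun i =>
    if i ∈ S then {t | |otScale i.1 * t - coeffs ψ f i| ≤ (√n)⁻¹}
    else {t | |otScale i.1 * t| ≤ (√n)⁻¹ * (1 / 2) ^ i.1}
  have ht : ∀ i, MeasurableSet (t i) := fun i => by
    simp only [t]
    split_ifs
    · exact measurableSet_le (by fun_prop) measurable_const
    · exact measurableSet_le (by fun_prop) measurable_const
  have hsub : Set.univ.pi t ⊆ otSeries ψ ⁻¹' {g : L2Unit | ‖g - f‖ ≤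
      √((6 + 3 * L ^ r) * (n : ℝ) ^ (1 / (2 * β + 1)) / n)} := fun ζ hζ => by
    refine norm_otSeries_sub_le hf hn hβ hr hβr hcard hS2 (fun i hi => ?_) fun i hi => ?_
    · have := hζ i trivial
      rwa [show t i = _ from if_pos hi] at this
    · have := hζ i trivial
      rwa [show t i = _ from if_neg hi] at this
  refine le_trans ?_ (measure_mono hsub)
  have hcoeff : ∀ i, |coeffs ψ f i| ≤ ‖f‖ := fun i => by
    have := abs_real_inner_le_norm (ψ i) f
    rwa [ψ.orthonormal.norm_eq_one, one_mul] at this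
  have hsum : ∑' i : WaveletIndex, ENNReal.ofReal (1 / 4 * (1 / 4) ^ i.1) ≤ 1 / 2 := by
    have h1 := hasSum_inv_four_pow_waveletIndex.mul_left (1 / 4)
    rw [← ENNReal.ofReal_tsum_of_nonneg (fun i => by positivity) h1.summable, h1.tsum_eq,
      show (1 / 4 * 2 : ℝ) = 1 / 2 by norm_num, ENNReal.ofReal_div_of_pos (by norm_num)]
    simp
  refine le_trans ?_ (le_infinitePi_pi_univ (fun _ : WaveletIndex => H) ht S
    (m := ENNReal.ofReal (Real.exp (-(C * Real.log n ^ (2 + 2 * κ))))) (fun i hi => ?_)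
    (fun i hi => ?_) hsum)
  · set Λ := Real.log n ^ (2 + 2 * κ)
    set N := (n : ℝ) ^ (1 / (2 * β + 1))
    have hΛ1 : 1 ≤ Λ := Real.one_le_rpow hlogn (by positivity)
    have hN1 : 1 ≤ N := Real.one_le_rpow hn (by positivity)
    have hhalf : (1 / 2 : ℝ≥0∞) = ENNReal.ofReal (1 / 2) := by
      rw [ENNReal.ofReal_div_of_pos (by norm_num)]; simp
    have he : Real.exp (-1) ≤ 1 / 2 := by
      rw [Real.exp_neg, one_div]
      apply inv_anti₀ (by norm_num)
      linarith [Real.add_one_le_exp (1 : ℝ)]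
    rw [hhalf, ← ENNReal.ofReal_pow (Real.exp_pos _).le,
      ← ENNReal.ofReal_mul (by positivity), ← Real.exp_nat_mul]
    refine ENNReal.ofReal_le_ofReal ?_
    calc Real.exp (-((C * (2 + L ^ r) + 1) * Λ * N))
        ≤ Real.exp (S.card * -(C * Λ)) * Real.exp (-1) := by
          rw [← Real.exp_add]
          refine Real.exp_le_exp.2 ?_
          have h1 : S.card * (C * Λ) ≤ (2 + L ^ r) * N * (C * Λ) := by gcongr
          have h2 : 1 ≤ Λ * N := by nlinarith
          nlinarith
      _ ≤ _ := by gcongr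
  · simp only [t, if_pos hi]
    exact hC n hn hlogn i.1 (hK n hlogn hn i (hS1 i hi)) _ (hcoeff i)
  · simp only [t, if_neg hi]
    exact hl₀ n hn hpown i.1 (hS2 i hi).1

end

theorem theorem10
    (ψ : DoubleIndexBasis)
    (H : Measure ℝ) [IsProbabilityMeasure H] (h : ℝ → ℝ)
    (hH : H = volume.withDensity (fun x => ENNReal.ofReal (h x)))
    (c₁ c₂ κ : ℝ) (hc₁ : 0 < c₁) (hc₂ : 0 < c₂) (hκ : 0 ≤ κ)
    (hh : IsHeavyTailDensity h c₁ κ)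
    (htail : ∀ x : ℝ, 1 ≤ x → ∫ u in Ioi x, h u ≤ c₂ / x ^ 2)
    (β L r : ℝ) (hβ : 0 < β) (hL : 0 < L) (hr : r ∈ Icc (1 : ℝ) 2) (hβr : 1 / r - 1 / 2 < β) :
    ∃ d : ℝ, 0 < d ∧
      ∀ f₀ ∈ besovBall ψ β r L, ∀ ρ : ℝ, 0 < ρ → ρ < 1 →
        Tendsto
          (fun n : ℕ => ∫⁻ x, temperedPosterior ψ (otPrior ψ H) ρ n x
              {f | Real.log n ^ d * (n : ℝ) ^ (-(β / (2 * β + 1))) < ‖f - f₀‖}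
            ∂(obsLaw ψ n f₀))
          atTop (𝓝 0) := by
  -- With this `d`, `nT² = Λ²N` where `Λ = log^d n`, against a prior cost of order `ΛN`.
  refine ⟨2 + 2 * κ, by positivity, fun f₀ hf₀ ρ hρ hρ1 => ?_⟩
  have hprob : IsProbabilityMeasure (volume.withDensity fun x => ENNReal.ofReal (h x)) := by
    rw [← hH]; infer_instance
  obtain ⟨C, hC0, hC⟩ := exists_exp_le_otPrior_ball ψ hprob hc₁ hc₂ hκ hh htail hβ hL hr hβr hf₀
  rw [← hH] at hC
  set c := ρ * (1 - ρ) / 4 with hc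
  have hcpos : 0 < c := by
    have : 0 < 1 - ρ := by linarith
    positivity
  set D := C / 2 + ρ * (1 + ρ) / 4 * (6 + 3 * L ^ r) with hD
  have hDpos : 0 < D := by positivity
  have hlog : Tendsto (fun n : ℕ => Real.log n) atTop atTop :=
    Real.tendsto_log_atTop.comp tendsto_natCast_atTop_atTop
  -- From here on `cΛ ≥ D + 1`, so the exponent `DΛN - cΛ²N` is at most `-ΛN ≤ -log n`.
  have hbig : ∀ᶠ n : ℕ in atTop, (D + 1) / c ≤ Real.log n := hlog.eventually_ge_atTop _
  have hzero : Tendsto (fun n : ℕ => ENNReal.ofReal (Real.exp (-Real.log n))) atTop (𝓝 0) := by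
    have h1 : Tendsto (fun n : ℕ => Real.exp (-Real.log n)) atTop (𝓝 0) :=
      Real.tendsto_exp_atBot.comp (tendsto_neg_atTop_atBot.comp hlog)
    rw [← ENNReal.ofReal_zero]
    exact (ENNReal.continuous_ofReal.tendsto 0).comp h1
  refine tendsto_of_tendsto_of_tendsto_of_le_of_le' tendsto_const_nhds hzero
    (Eventually.of_forall fun n => bot_le) ?_
  filter_upwards [hC, hbig, hlog.eventually_ge_atTop 1, eventually_ge_atTop 1] with n hCn hbign
    hlogn hn1
  have hn : (1 : ℝ) ≤ n := by exact_mod_cast hn1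
  have hn0 : (0 : ℝ) < n := by linarith
  set N := (n : ℝ) ^ (1 / (2 * β + 1)) with hN
  set Λ := Real.log n ^ (2 + 2 * κ) with hΛ
  have hN1 : 1 ≤ N := Real.one_le_rpow hn (by positivity)
  have hΛ1 : Real.log n ≤ Λ := by
    calc Real.log n = Real.log n ^ (1 : ℝ) := (Real.rpow_one _).symm
      _ ≤ _ := Real.rpow_le_rpow_of_exponent_le hlogn (by linarith)
  set T := Λ * (n : ℝ) ^ (-(β / (2 * β + 1))) with hT
  set ε := √((6 + 3 * L ^ r) * N / n) with hε
  have hεsq : n * ε ^ 2 = (6 + 3 * L ^ r) * N := by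
    rw [hε, Real.sq_sqrt (by positivity)]
    field_simp
  have hTsq : n * T ^ 2 = Λ ^ 2 * N := by
    have h1 : (n : ℝ) * ((n : ℝ) ^ (-(β / (2 * β + 1)))) ^ 2 = N := by
      nth_rw 1 [← Real.rpow_one (n : ℝ)]
      rw [← Real.rpow_natCast, ← Real.rpow_mul hn0.le, ← Real.rpow_add hn0, hN]
      congr 1
      push_cast
      field_simp
      ring
    rw [hT, mul_pow, ← h1]
    ring
  have hmass : otPrior ψ H {f | ‖f - f₀‖ ≤ ε} ≠ 0 := by
    intro h0
    rw [h0] at hCn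
    have := ENNReal.ofReal_pos.2 (Real.exp_pos (-(C * Λ * N)))
    exact absurd hCn (not_le.2 this)
  refine (lintegral_temperedPosterior_le ψ (otPrior ψ H) (by omega) f₀ hρ hρ1
    (T := T) (ε := ε) (by positivity) hmass).trans ?_
  calc _ ≤ (ENNReal.ofReal (Real.exp (-(C * Λ * N))))⁻¹ ^ (1 / 2 : ℝ) *
        ENNReal.ofReal (Real.exp
          (n * (ρ * (1 + ρ)) / 4 * ε ^ 2 - n * (ρ * (1 - ρ)) / 4 * T ^ 2)) := by
        gcongr
    _ = ENNReal.ofReal (Real.exp (C * Λ * N / 2 + ρ * (1 + ρ) / 4 * (n * ε ^ 2)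
          - c * (n * T ^ 2))) := by
        rw [← ENNReal.ofReal_inv_of_pos (Real.exp_pos _), ← Real.exp_neg,
          ENNReal.ofReal_rpow_of_pos (Real.exp_pos _), ← Real.exp_mul,
          ← ENNReal.ofReal_mul (Real.exp_pos _).le, ← Real.exp_add]
        congr 2
        rw [hc]
        ring
    _ ≤ _ := by
        refine ENNReal.ofReal_le_ofReal (Real.exp_le_exp.2 ?_)
        rw [hεsq, hTsq]
        have h1 : D + 1 ≤ c * Λ := by
          rw [div_le_iff₀ hcpos] at hbign
          nlinarith
        have hΛ1' : 1 ≤ Λ := hlogn.trans hΛ1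
        have h2 : C * Λ * N / 2 + ρ * (1 + ρ) / 4 * ((6 + 3 * L ^ r) * N) ≤ D * (Λ * N) := by
          have h3 : ρ * (1 + ρ) / 4 * (6 + 3 * L ^ r) * N
              ≤ ρ * (1 + ρ) / 4 * (6 + 3 * L ^ r) * (Λ * N) := by
            gcongr
            nlinarith
          rw [hD]
          nlinarith
        have h4 : (D + 1) * (Λ * N) ≤ c * Λ * (Λ * N) := by gcongr
        have h5 : Λ ≤ Λ * N := le_mul_of_one_le_right (by linarith) hN1
        nlinarith
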